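/- Let $X$ be a Riemann surface, i.e. a connected Hausdorff complex manifold of dimension $1$ (second countability is not assumed), and let $K\subset X$ be a sub-surface with smooth boundary, not necessarily compact, closed or connected: every point $p\in K$ either lies in the topological interior $\mathring K$ of $K$, or has an open neighbourhood $U$ in $X$ with $K\cap U=\{\rho\le 0\}$ for some smooth function $\rho:U\to\mathbb R$ with $d\rho_p\neq 0$. Write $\partial K=K\setminus\mathring K$ and assume that $\partial K\neq\emptyset$. Call a real function on an open subset $W$ of $X$ harmonic if it is continuous and, for every holomorphic chart $\varphi:U\to\mathbb C$ with $U\subset W$ open and $\overline{\mathbb D}\subset\varphi(U)$, its value at $\varphi^{-1}(0)$ equals its mean $\frac1{2\pi}\int_0^{2\pi}u(\varphi^{-1}(e^{it}))\,dt$ over the circle $\varphi^{-1}(S^1)$. Then for every $x_0\in\mathring K$ there exists a continuous function $G:K\setminus\{x_0\}\to[0,\infty)$ which is harmonic on the interior of $K\setminus\{x_0\}$, vanishes on $\partial K$, and has a logarithmic pole at $x_0$: for every local holomorphic coordinate $\xi$ centred at $x_0$, the function $G+\log|\xi|$ extends over $x_0$ to a harmonic function on a neighbourhood of $x_0$. 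-/

import Mathlib

open scoped Manifold ContDiff

/-- A holomorphic coordinate on an open part of the Riemann surface `X`: a chart in the maximal
holomorphic atlas. -/
def IsHolomorphicChart {X : Type*} [TopologicalSpace X] [ChartedSpace ℂ X]
    (φ : OpenPartialHomeomorph X ℂ) : Prop :=
  φ ∈ IsManifold.maximalAtlas 𝓘(ℂ) ω X

/-- `K` is a sub-surface with smooth boundary (an embedded codimension zero submanifold with
boundary): near each of its points that is not interior, `K` is the sublevel set `{ρ ≤ 0}` of a
smooth real function `ρ` with non-vanishing differential. (Then `ρ` vanishes at the point.) -/
def IsSubsurfaceWithSmoothBoundary {X : Type*} [TopologicalSpace X] [ChartedSpace ℂ X]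
    (K : Set X) : Prop :=
  ∀ p ∈ K, p ∉ interior K →
    ∃ (φ : OpenPartialHomeomorph X ℂ) (ρ : ℂ → ℝ),
      IsHolomorphicChart φ ∧ p ∈ φ.source ∧
      ContDiffOn ℝ ∞ ρ φ.target ∧ fderiv ℝ ρ (φ p) ≠ 0 ∧
      ∀ x ∈ φ.source, (x ∈ K ↔ ρ (φ x) ≤ 0)

/-- The boundary `∂K` of a sub-surface with boundary: the points of `K` that are not interior. -/
def subsurfaceBoundary {X : Type*} [TopologicalSpace X] (K : Set X) : Set X :=
  K \ interior K

/-- `u` is harmonic on the open set `W`: it is continuous there, and for every disk in `W`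
(the preimage of the unit disk under a holomorphic chart `φ` with domain in `W` whose image
contains the closed unit disk) its value at the centre is its mean over the boundary circle. -/
def IsHarmonicOn {X : Type*} [TopologicalSpace X] [ChartedSpace ℂ X]
    (u : X → ℝ) (W : Set X) : Prop :=
  ContinuousOn u W ∧
    ∀ φ : OpenPartialHomeomorph X ℂ, IsHolomorphicChart φ → φ.source ⊆ W →
      Metric.closedBall (0 : ℂ) 1 ⊆ φ.target →
      Real.circleAverage (fun z => u (φ.symm z)) 0 1 = u (φ.symm 0)

/-- `G` has a logarithmic pole at `x₀`: for every holomorphic coordinate `ξ` centred at `x₀`, the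
function `G + log |ξ|` (extended over `x₀`) is harmonic on a neighbourhood of `x₀`. -/
def HasLogarithmicPole {X : Type*} [TopologicalSpace X] [ChartedSpace ℂ X]
    (G : X → ℝ) (x₀ : X) : Prop :=
  ∀ ξ : OpenPartialHomeomorph X ℂ, IsHolomorphicChart ξ → x₀ ∈ ξ.source → ξ x₀ = 0 →
    ∃ (V : Set X) (H : X → ℝ), IsOpen V ∧ x₀ ∈ V ∧ V ⊆ ξ.source ∧ IsHarmonicOn H V ∧
      ∀ x ∈ V \ {x₀}, H x = G x + Real.log ‖ξ x‖

/-!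
The Green function of `Y = interior K` is the upper envelope of the compactly supported functions
that are subharmonic off `x₀` and have at most a logarithmic pole there. Everything rests on a bound
for these competitors that does not depend on the competitor. Since `Y` is not dense, a competitor
normalised to be at most `1` outside half a coordinate disk vanishes on a fixed open set; Poisson
integrals carry this deficit along the connected surface, so the competitor is at most a fixed
`θ < 1` on the unit circle. Comparison with `-log ‖φ‖`, on the other hand, lets a competitor exceed
its maximum `m` over the unit circle by at most `log 2` outside the half disk. Hence
`m ≤ θ (m + log 2)`, which bounds `m`.

The envelope of a directed family closed under Poisson modification is harmonic by Harnack's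
inequality, without any countability of the surface. Its singularity at `x₀` is removable up to the
logarithm, and logarithmic barriers at the tangent exterior disks give its boundary values.
-/

open Complex Metric Set Filter Topology Real InnerProductSpace

/-! ### Poisson integrals -/

/-- The Poisson integral, at the point `w`, of the boundary values `g` on the circle of centre `c`
and radius `R`. It is meant for `w` inside the circle. -/
noncomputable def poissonIntegral (g : ℂ → ℝ) (c : ℂ) (R : ℝ) (w : ℂ) : ℝ :=
  circleAverage (poissonKernel c w • g) c R

section PoissonIntegral

variable {g g₁ g₂ : ℂ → ℝ} {c w z : ℂ} {R : ℝ}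

lemma continuousOn_poissonKernel_sphere (hw : w ∈ ball c R) :
    ContinuousOn (poissonKernel c w) (sphere c |R|) := by
  rw [poissonKernel_eq_re_herglotzRieszKernel]
  exact continuous_re.comp_continuousOn (continuousOn_herglotzRieszKernel_sphere hw)

lemma poissonKernel_le (hw : w ∈ ball c R) (hz : z ∈ sphere c R) :
    poissonKernel c w z ≤ (R + ‖w - c‖) / (R - ‖w - c‖) := by
  rw [poissonKernel_eq_re_herglotzRieszKernel]
  exact re_herglotzRieszKernel_le hz hw

lemma le_poissonKernel (hw : w ∈ ball c R) (hz : z ∈ sphere c R) :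
    (R - ‖w - c‖) / (R + ‖w - c‖) ≤ poissonKernel c w z := by
  rw [poissonKernel_eq_re_herglotzRieszKernel]
  exact le_re_herglotzRieszKernel hz hw

lemma poissonKernel_nonneg (hw : w ∈ ball c R) (hz : z ∈ sphere c R) :
    0 ≤ poissonKernel c w z := by
  have hwR : ‖w - c‖ < R := mem_ball_iff_norm.1 hw
  have hR : 0 ≤ R := (norm_nonneg _).trans hwR.le
  exact (div_nonneg (sub_nonneg.2 hwR.le) (by positivity)).trans (le_poissonKernel hw hz)

lemma circleIntegrable_poissonKernel_smul (hg : CircleIntegrable g c R) (hw : w ∈ ball c R) :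
    CircleIntegrable (poissonKernel c w • g) c R :=
  hg.continuousOn_smul (continuousOn_poissonKernel_sphere hw)

lemma poissonIntegral_center (hR : R ≠ 0) : poissonIntegral g c R c = circleAverage g c R := by
  refine circleAverage_congr_sphere fun z hz ↦ ?_
  have hz' : ‖z - c‖ ≠ 0 := by simpa [mem_sphere_iff_norm.1 hz] using hR
  simp [poissonKernel_def, div_self (pow_ne_zero 2 hz')]

lemma poissonIntegral_mono (hg₁ : CircleIntegrable g₁ c R) (hg₂ : CircleIntegrable g₂ c R)
    (hw : w ∈ ball c R) (hle : ∀ z ∈ sphere c R, g₁ z ≤ g₂ z) :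
    poissonIntegral g₁ c R w ≤ poissonIntegral g₂ c R w := by
  refine circleAverage_mono (circleIntegrable_poissonKernel_smul hg₁ hw)
    (circleIntegrable_poissonKernel_smul hg₂ hw) fun z hz ↦ ?_
  rw [abs_of_pos (pos_of_mem_ball hw)] at hz
  exact mul_le_mul_of_nonneg_left (hle z hz) (poissonKernel_nonneg hw hz)

lemma poissonIntegral_neg : poissonIntegral (-g) c R w = -poissonIntegral g c R w := by
  have hsmul : poissonKernel c w • (-g) = (-1 : ℝ) • (poissonKernel c w • g) := by ext; simp
  rw [poissonIntegral, hsmul, circleAverage_smul, neg_one_smul, poissonIntegral]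

lemma poissonIntegral_add (hg₁ : CircleIntegrable g₁ c R) (hg₂ : CircleIntegrable g₂ c R)
    (hw : w ∈ ball c R) : poissonIntegral (g₁ + g₂) c R w =
      poissonIntegral g₁ c R w + poissonIntegral g₂ c R w := by
  rw [poissonIntegral, smul_add, circleAverage_add (circleIntegrable_poissonKernel_smul hg₁ hw)
    (circleIntegrable_poissonKernel_smul hg₂ hw), poissonIntegral, poissonIntegral]

lemma poissonIntegral_eq_of_harmonicOnNhd (hg : HarmonicOnNhd g (closedBall c R))
    (hw : w ∈ ball c R) : poissonIntegral g c R w = g w :=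
  hg.circleAverage_poissonKernel_smul hw

lemma poissonIntegral_const (a : ℝ) (hw : w ∈ ball c R) :
    poissonIntegral (fun _ ↦ a) c R w = a :=
  poissonIntegral_eq_of_harmonicOnNhd (harmonicOnNhd_const a) hw

lemma poissonIntegral_le_harnack (hg : CircleIntegrable g c R) (hw : w ∈ ball c R)
    (hpos : ∀ z ∈ sphere c R, 0 ≤ g z) :
    poissonIntegral g c R w ≤ (R + ‖w - c‖) / (R - ‖w - c‖) * poissonIntegral g c R c := by
  have hR := pos_of_mem_ball hw
  rw [poissonIntegral_center hR.ne', ← smul_eq_mul, ← circleAverage_smul]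
  refine circleAverage_mono (circleIntegrable_poissonKernel_smul hg hw) hg.const_smul fun z hz ↦ ?_
  rw [abs_of_pos hR] at hz
  exact mul_le_mul_of_nonneg_right (poissonKernel_le hw hz) (hpos z hz)

lemma harnack_le_poissonIntegral (hg : CircleIntegrable g c R) (hw : w ∈ ball c R)
    (hpos : ∀ z ∈ sphere c R, 0 ≤ g z) :
    (R - ‖w - c‖) / (R + ‖w - c‖) * poissonIntegral g c R c ≤ poissonIntegral g c R w := by
  have hR := pos_of_mem_ball hw
  rw [poissonIntegral_center hR.ne', ← smul_eq_mul, ← circleAverage_smul]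
  refine circleAverage_mono hg.const_smul (circleIntegrable_poissonKernel_smul hg hw) fun z hz ↦ ?_
  rw [abs_of_pos hR] at hz
  exact mul_le_mul_of_nonneg_right (le_poissonKernel hw hz) (hpos z hz)

lemma poissonIntegral_comp_add_const :
    poissonIntegral (fun z ↦ g (z + c)) 0 R (w - c) = poissonIntegral g c R w := by
  rw [poissonIntegral, poissonIntegral, ← circleAverage_map_add_const (c := c)]
  congr 1
  ext z
  simp [poissonKernel_def]

lemma harmonicAt_poissonIntegral (hg : CircleIntegrable g c R) (hw : w ∈ ball c R) :
    HarmonicAt (poissonIntegral g c R) w := by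
  have hg₀ : CircleIntegrable (fun z ↦ g (z + c)) 0 R := by
    simpa [CircleIntegrable, circleMap, add_comm] using hg
  have hgℂ : CircleIntegrable (fun z ↦ (g (z + c) : ℂ)) 0 R := by
    simp only [CircleIntegrable, intervalIntegrable_iff] at hg₀ ⊢
    exact ofRealCLM.integrable_comp hg₀
  have hball : ∀ {y}, y ∈ ball c R ↔ y - c ∈ ball 0 R := by simp [dist_eq_norm]
  have hanalytic : AnalyticAt ℂ (fun y ↦ circleAverage
      (fun ζ ↦ herglotzRieszKernel 0 (y - c) ζ • (g (ζ + c) : ℂ)) 0 R) w :=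
    AnalyticAt.fun_comp (f := fun y ↦ y - c)
      (analyticOnNhd_circleAverage_herglotzRieszKernel_smul hgℂ _ (hball.1 hw)) (by fun_prop)
  refine (harmonicAt_congr_nhds ?_).2 hanalytic.harmonicAt_re
  filter_upwards [isOpen_ball.mem_nhds hw] with y hy
  rw [re_circleAverage_herglotzRieszKernel_smul hg₀ (hball.1 hy),
    ← poissonKernel_eq_re_herglotzRieszKernel, ← poissonIntegral_comp_add_const, poissonIntegral]

lemma exists_forall_le_add_mul_dist_sq {E : Type*} [PseudoMetricSpace E] {S : Set E}
    {f : E → ℝ} {p : E} {a : ℝ} (hS : IsCompact S) (hf : ContinuousOn f S) (hp : p ∈ S)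
    (ha : f p < a) : ∃ N : ℝ, ∀ z ∈ S, f z ≤ a + N * dist z p ^ 2 := by
  obtain ⟨δ, hδ, hnear⟩ := Metric.mem_nhdsWithin_iff.1 ((hf p hp).eventually (gt_mem_nhds ha))
  obtain ⟨M, hM⟩ := hS.bddAbove_image hf
  refine ⟨(|M| + |a|) / δ ^ 2, fun z hz ↦ ?_⟩
  by_cases hzδ : dist z p < δ
  · exact (hnear ⟨hzδ, hz⟩).le.trans (le_add_of_nonneg_right (by positivity))
  · have hfar : |M| + |a| ≤ (|M| + |a|) / δ ^ 2 * dist z p ^ 2 := by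
      rw [div_mul_eq_mul_div, le_div_iff₀ (by positivity)]
      gcongr
      exact not_lt.1 hzδ
    linarith [hM (mem_image_of_mem f hz), le_abs_self M, neg_abs_le a]

lemma dist_sq_eq_of_mem_sphere {ζ : ℂ} (hz : z ∈ sphere c R) (hζ : ζ ∈ sphere c R) :
    dist z ζ ^ 2 = (2 * (starRingEnd ℂ (ζ - c) * (ζ - z))).re := by
  have hzR : (z.re - c.re) ^ 2 + (z.im - c.im) ^ 2 = R ^ 2 := by
    rw [← mem_sphere.1 hz, Complex.dist_eq, ← normSq_eq_norm_sq, normSq_apply, sub_re, sub_im]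
    ring
  have hζR : (ζ.re - c.re) ^ 2 + (ζ.im - c.im) ^ 2 = R ^ 2 := by
    rw [← mem_sphere.1 hζ, Complex.dist_eq, ← normSq_eq_norm_sq, normSq_apply, sub_re, sub_im]
    ring
  rw [Complex.dist_eq, ← normSq_eq_norm_sq, normSq_apply]
  simp only [sub_re, sub_im, mul_re, mul_im, conj_re, conj_im, re_ofNat, im_ofNat]
  linear_combination hzR - hζR

lemma eventually_poissonIntegral_lt (hg : ContinuousOn g (sphere c R)) {ζ : ℂ}
    (hζ : ζ ∈ sphere c R) {b : ℝ} (hb : g ζ < b) :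
    ∀ᶠ w in 𝓝[ball c R] ζ, poissonIntegral g c R w < b := by
  obtain ⟨a, hga, hab⟩ := exists_between hb
  obtain ⟨N, hN⟩ := exists_forall_le_add_mul_dist_sq (isCompact_sphere c R) hg hζ hga
  -- On the circle, the majorant `a + N * dist z ζ ^ 2` coincides with a harmonic function.
  set h : ℂ → ℝ := fun z ↦ ((a : ℂ) + N * (2 * (starRingEnd ℂ (ζ - c) * (ζ - z)))).re
  have hharm : HarmonicOnNhd h (closedBall c R) := fun z _ ↦
    AnalyticAt.harmonicAt_re (f := fun z ↦ (a : ℂ) + N * (2 * (starRingEnd ℂ (ζ - c) * (ζ - z))))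
      (by fun_prop)
  have hcont : Continuous h := by fun_prop
  have hle : ∀ z ∈ sphere c R, g z ≤ h z := fun z hz ↦ by
    simpa only [h, add_re, ofReal_re, re_ofReal_mul, ← dist_sq_eq_of_mem_sphere hz hζ] using hN z hz
  have hhζ : h ζ < b := by simpa [h] using hab
  have hR : 0 ≤ R := dist_nonneg.trans_eq hζ
  filter_upwards [(hcont.continuousAt.eventually (gt_mem_nhds hhζ)).filter_mono nhdsWithin_le_nhds,
    self_mem_nhdsWithin] with w hwb hw
  calc poissonIntegral g c R w
      ≤ poissonIntegral h c R w := poissonIntegral_mono (hg.circleIntegrable hR)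
        (hcont.continuousOn.circleIntegrable hR) hw hle
    _ = h w := poissonIntegral_eq_of_harmonicOnNhd hharm hw
    _ < b := hwb

lemma tendsto_poissonIntegral (hg : ContinuousOn g (sphere c R)) {ζ : ℂ}
    (hζ : ζ ∈ sphere c R) : Tendsto (poissonIntegral g c R) (𝓝[ball c R] ζ) (𝓝 (g ζ)) := by
  refine tendsto_order.2 ⟨fun a ha ↦ ?_, fun b hb ↦ eventually_poissonIntegral_lt hg hζ hb⟩
  filter_upwards [eventually_poissonIntegral_lt hg.neg hζ (neg_lt_neg ha)] with w hw
  rw [poissonIntegral_neg] at hw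
  exact neg_lt_neg_iff.1 hw

end PoissonIntegral

/-! ### Coordinate disks -/

/-- A coordinate disk of the Riemann surface: a holomorphic chart whose image contains the closed
unit disk. The disk itself is the preimage of the unit disk, and its centre is `φ.symm 0`. -/
structure IsCoordinateDisk {X : Type*} [TopologicalSpace X] [ChartedSpace ℂ X]
    (φ : OpenPartialHomeomorph X ℂ) : Prop where
  isHolomorphicChart : IsHolomorphicChart φ
  closedBall_subset : closedBall 0 1 ⊆ φ.target

/-- The part of the domain of the chart `φ` that `φ` maps into `s`. -/
def chartPreimage {X : Type*} [TopologicalSpace X] (φ : OpenPartialHomeomorph X ℂ) (s : Set ℂ) :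
    Set X :=
  φ.source ∩ φ ⁻¹' s

section ChartPreimage

variable {X : Type*} [TopologicalSpace X] {φ : OpenPartialHomeomorph X ℂ} {v : X → ℝ} {x : X}
  {s t : Set ℂ}

lemma chartPreimage_mono (hst : s ⊆ t) : chartPreimage φ s ⊆ chartPreimage φ t :=
  inter_subset_inter_right _ (preimage_mono hst)

lemma isOpen_chartPreimage (hs : IsOpen s) : IsOpen (chartPreimage φ s) :=
  φ.isOpen_inter_preimage hs

lemma isCompact_chartPreimage (hs : IsCompact s) (hst : s ⊆ φ.target) :
    IsCompact (chartPreimage φ s) := by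
  rw [chartPreimage, ← φ.symm_image_eq_source_inter_preimage hst]
  exact hs.image_of_continuousOn (φ.continuousOn_symm.mono hst)

lemma symm_mem_chartPreimage {z : ℂ} (hzt : z ∈ φ.target) (hz : z ∈ s) :
    φ.symm z ∈ chartPreimage φ s :=
  ⟨φ.map_target hzt, by simpa [φ.right_inv hzt] using hz⟩

lemma chartPreimage_ne_univ {z : ℂ} (hzt : z ∈ φ.target) (hz : z ∉ s) :
    chartPreimage φ s ≠ univ := by
  intro huniv
  have hmem : φ.symm z ∈ chartPreimage φ s := huniv ▸ mem_univ _
  exact hz (by simpa [φ.right_inv hzt] using hmem.2)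

lemma continuousOn_comp_symm (hst : s ⊆ φ.target)
    (hv : ∀ x ∈ chartPreimage φ s, ContinuousAt v x) : ContinuousOn (v ∘ φ.symm) s :=
  fun _ hz ↦ ((hv _ (symm_mem_chartPreimage (hst hz) hz)).comp
    (φ.continuousAt_symm (hst hz))).continuousWithinAt

lemma tendsto_symm_of_mem_source (hx : x ∈ φ.source) : Tendsto φ.symm (𝓝 (φ x)) (𝓝 x) := by
  simpa [ContinuousAt, φ.left_inv hx] using φ.continuousAt_symm (φ.map_source hx)

lemma eventually_forall_closedBall_of_eventually {P : X → Prop} (hP : ∀ᶠ y in 𝓝 x, P y)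
    (hx : x ∈ φ.source) :
    ∀ᶠ r in 𝓝[>] (0 : ℝ), 0 < r ∧ ∀ z ∈ closedBall (φ x) r, z ∈ φ.target ∧ P (φ.symm z) := by
  obtain ⟨R, hR, hRs⟩ := Metric.nhds_basis_closedBall.mem_iff.1
    ((φ.open_target.eventually_mem (φ.map_source hx)).and
      ((tendsto_symm_of_mem_source hx).eventually hP))
  filter_upwards [Ioc_mem_nhdsGT hR] with r hr
  exact ⟨hr.1, fun z hz ↦ hRs (closedBall_subset_closedBall hr.2 hz)⟩

lemma eventually_circleIntegrable (hv : ∀ᶠ y in 𝓝 x, ContinuousAt v y) (hx : x ∈ φ.source) :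
    ∀ᶠ r in 𝓝[>] (0 : ℝ), CircleIntegrable (v ∘ φ.symm) (φ x) r := by
  filter_upwards [eventually_forall_closedBall_of_eventually hv hx] with r ⟨hr, hball⟩
  have hcont : ContinuousOn (v ∘ φ.symm) (closedBall (φ x) r) := fun z hz ↦
    ((hball z hz).2.comp (φ.continuousAt_symm (hball z hz).1)).continuousWithinAt
  exact (hcont.mono sphere_subset_closedBall).circleIntegrable hr.le

end ChartPreimage

section CoordinateDisk

variable {X : Type*} [TopologicalSpace X] [ChartedSpace ℂ X]
  {φ ψ : OpenPartialHomeomorph X ℂ} {W : Set X} {x : X}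

lemma IsHolomorphicChart.analyticAt_comp_symm (hφ : IsHolomorphicChart φ)
    (hψ : IsHolomorphicChart ψ) {z : ℂ} (hz : z ∈ ψ.target) (hzφ : ψ.symm z ∈ φ.source) :
    AnalyticAt ℂ (φ ∘ ψ.symm) z :=
  (contMDiffAt_iff_contDiffAt.1 ((contMDiffAt_of_mem_maximalAtlas hφ hzφ).comp z
    (contMDiffAt_symm_of_mem_maximalAtlas hψ hz))).analyticAt

variable [IsManifold 𝓘(ℂ) ω X]

lemma isHolomorphicChart_chartAt (x : X) : IsHolomorphicChart (chartAt ℂ x) :=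
  IsManifold.chart_mem_maximalAtlas x

lemma IsHolomorphicChart.transHomeomorph (hφ : IsHolomorphicChart φ) {e : ℂ ≃ₜ ℂ}
    (he : ContDiff ℂ ω e) (he' : ContDiff ℂ ω e.symm) :
    IsHolomorphicChart (φ.transHomeomorph e) :=
  OpenPartialHomeomorph.mem_maximalAtlas_of_contMDiffOn _
    (he.contMDiff.comp_contMDiffOn (contMDiffOn_of_mem_maximalAtlas hφ))
    ((contMDiffOn_symm_of_mem_maximalAtlas hφ).comp he'.contMDiff.contMDiffOn fun _ hz ↦ hz)

lemma IsHolomorphicChart.exists_isCoordinateDisk_rescale (hφ : IsHolomorphicChart φ) {c : ℂ}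
    {r : ℝ} (hr : 0 < r) (hW : IsOpen W)
    (hball : ∀ z ∈ closedBall c r, z ∈ φ.target ∧ φ.symm z ∈ W) :
    ∃ ψ : OpenPartialHomeomorph X ℂ, IsCoordinateDisk ψ ∧ ψ.source = φ.source ∩ W ∧
      (∀ y, ψ y = (r : ℂ)⁻¹ * (φ y - c)) ∧ ∀ z, ψ.symm z = φ.symm (r * z + c) := by
  have hr' : (r : ℂ) ≠ 0 := ofReal_ne_zero.2 hr.ne'
  let e : ℂ ≃ₜ ℂ := (DilationEquiv.smulTorsor c hr').toHomeomorph.symm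
  have he : ⇑e = fun y ↦ (r : ℂ)⁻¹ * (y - c) := rfl
  have he' : ⇑e.symm = fun z ↦ (r : ℂ) * z + c := rfl
  have hchart : IsHolomorphicChart (φ.transHomeomorph e) :=
    hφ.transHomeomorph (by rw [he]; fun_prop) (by rw [he']; fun_prop)
  refine ⟨(φ.transHomeomorph e).restr W,
    ⟨restr_mem_maximalAtlas _ hchart hW, fun z hz ↦ ?_⟩, by simp [hW.interior_eq],
    fun y ↦ congrFun he (φ y), fun z ↦ congrArg φ.symm (congrFun he' z)⟩
  have hz' : e.symm z ∈ closedBall c r := by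
    have hz1 : ‖z‖ ≤ 1 := mem_closedBall_zero_iff.1 hz
    simp [he', abs_of_pos hr, mul_le_of_le_one_right hr.le hz1]
  simpa [hW.interior_eq] using hball _ hz'

lemma IsHolomorphicChart.exists_isCoordinateDisk (hφ : IsHolomorphicChart φ) (hx : x ∈ φ.source)
    (hW : W ∈ 𝓝 x) :
    ∃ r > (0 : ℝ), ∃ ψ : OpenPartialHomeomorph X ℂ, IsCoordinateDisk ψ ∧ x ∈ ψ.source ∧
      ψ.source ⊆ φ.source ∩ W ∧ ∀ y, ψ y = (r : ℂ)⁻¹ * (φ y - φ x) := by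
  obtain ⟨r, hr, hball⟩ := (eventually_forall_closedBall_of_eventually
    (eventually_mem_nhds_iff.2 hW) hx).exists
  obtain ⟨ψ, hψ, hsource, hψφ, -⟩ := hφ.exists_isCoordinateDisk_rescale hr isOpen_interior
    fun z hz ↦ ⟨(hball z hz).1, mem_interior_iff_mem_nhds.2 (hball z hz).2⟩
  exact ⟨r, hr, ψ, hψ, hsource ▸ ⟨hx, mem_interior_iff_mem_nhds.2 hW⟩,
    hsource.trans_subset (inter_subset_inter_right _ interior_subset), hψφ⟩

lemma exists_isCoordinateDisk_centered (hW : W ∈ 𝓝 x) :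
    ∃ ψ : OpenPartialHomeomorph X ℂ, IsCoordinateDisk ψ ∧ x ∈ ψ.source ∧ ψ.source ⊆ W ∧
      ψ x = 0 := by
  obtain ⟨r, -, ψ, hψ, hx, hsource, hψφ⟩ :=
    (isHolomorphicChart_chartAt x).exists_isCoordinateDisk (mem_chart_source ℂ x) hW
  exact ⟨ψ, hψ, hx, hsource.trans inter_subset_right, by simp [hψφ]⟩

end CoordinateDisk

/-! ### Harmonic and subharmonic functions -/

/-- `h` is harmonic near `x`: it is so in every holomorphic coordinate at `x`. -/
def IsHarmonicAt {X : Type*} [TopologicalSpace X] [ChartedSpace ℂ X] (h : X → ℝ) (x : X) : Prop :=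
  ∀ φ : OpenPartialHomeomorph X ℂ, IsHolomorphicChart φ → x ∈ φ.source →
    HarmonicAt (h ∘ φ.symm) (φ x)

/-- `v` is continuous near `x` and, in every holomorphic coordinate at `x`, its value at `x` is at
most its mean over all sufficiently small circles around `x`. -/
def IsSubharmonicAt {X : Type*} [TopologicalSpace X] [ChartedSpace ℂ X] (v : X → ℝ) (x : X) :
    Prop :=
  (∀ᶠ y in 𝓝 x, ContinuousAt v y) ∧
    ∀ φ : OpenPartialHomeomorph X ℂ, IsHolomorphicChart φ → x ∈ φ.source →
      ∀ᶠ r in 𝓝[>] (0 : ℝ), v x ≤ circleAverage (v ∘ φ.symm) (φ x) r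

lemma harmonicAt_comp_of_analyticAt {f : ℂ → ℝ} {p : ℂ → ℂ} {z : ℂ} (hf : HarmonicAt f (p z))
    (hp : AnalyticAt ℂ p z) : HarmonicAt (f ∘ p) z := by
  obtain ⟨R, hR, hfR⟩ := Metric.eventually_nhds_iff_ball.1 hf.eventually
  obtain ⟨F, hF, hFf⟩ := HarmonicOnNhd.exists_analyticOnNhd_ball_re_eq (f := f) hfR
  refine (harmonicAt_congr_nhds ?_).2 ((hF (p z) (mem_ball_self hR)).comp hp).harmonicAt_re
  filter_upwards [hp.continuousAt.preimage_mem_nhds (ball_mem_nhds _ hR)] with y hy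
  exact (hFf hy).symm

section Subharmonic

variable {X : Type*} [TopologicalSpace X] [ChartedSpace ℂ X]
  {φ : OpenPartialHomeomorph X ℂ} {x : X} {u v : X → ℝ}

lemma IsSubharmonicAt.continuousAt (hv : IsSubharmonicAt v x) : ContinuousAt v x :=
  hv.1.self_of_nhds

lemma isSubharmonicAt_const (c : ℝ) : IsSubharmonicAt (fun _ : X ↦ c) x :=
  ⟨.of_forall fun _ ↦ continuousAt_const, fun φ _ _ ↦ .of_forall fun r ↦
    (circleAverage_const c (φ x) r).ge⟩

lemma IsSubharmonicAt.add (hu : IsSubharmonicAt u x) (hv : IsSubharmonicAt v x) :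
    IsSubharmonicAt (u + v) x := by
  refine ⟨(hu.1.and hv.1).mono fun y hy ↦ hy.1.add hy.2, fun φ hφ hx ↦ ?_⟩
  filter_upwards [hu.2 φ hφ hx, hv.2 φ hφ hx, eventually_circleIntegrable hu.1 hx,
    eventually_circleIntegrable hv.1 hx] with r hur hvr hui hvi
  exact (add_le_add hur hvr).trans_eq (circleAverage_add hui hvi).symm

lemma IsSubharmonicAt.const_smul {c : ℝ} (hc : 0 ≤ c) (hv : IsSubharmonicAt v x) :
    IsSubharmonicAt (c • v) x := by
  refine ⟨hv.1.mono fun y hy ↦ hy.const_smul c, fun φ hφ hx ↦ ?_⟩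
  filter_upwards [hv.2 φ hφ hx] with r hvr
  have hsmul : (c • v) ∘ φ.symm = c • (v ∘ φ.symm) := rfl
  rw [hsmul, circleAverage_smul]
  exact mul_le_mul_of_nonneg_left hvr hc

lemma IsSubharmonicAt.of_le (hv : IsSubharmonicAt v x) (hu : ∀ᶠ y in 𝓝 x, ContinuousAt u y)
    (hx : u x = v x) (hle : v ≤ᶠ[𝓝 x] u) : IsSubharmonicAt u x := by
  refine ⟨hu, fun φ hφ hxφ ↦ ?_⟩
  filter_upwards [hv.2 φ hφ hxφ, eventually_circleIntegrable hu hxφ,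
    eventually_circleIntegrable hv.1 hxφ, eventually_forall_closedBall_of_eventually hle hxφ]
    with r hvr hui hvi ⟨hr, hball⟩
  rw [hx]
  refine hvr.trans (circleAverage_mono hvi hui fun z hz ↦ ?_)
  rw [abs_of_pos hr] at hz
  exact (hball z (sphere_subset_closedBall hz)).2

lemma IsSubharmonicAt.congr (hv : IsSubharmonicAt v x) (huv : u =ᶠ[𝓝 x] v) :
    IsSubharmonicAt u x := by
  refine hv.of_le ?_ huv.eq_of_nhds huv.symm.le
  filter_upwards [hv.1, huv.eventuallyEq_nhds] with y hy hyuv using hy.congr hyuv.symm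

lemma IsSubharmonicAt.sup (hu : IsSubharmonicAt u x) (hv : IsSubharmonicAt v x) :
    IsSubharmonicAt (u ⊔ v) x := by
  have hcont : ∀ᶠ y in 𝓝 x, ContinuousAt (u ⊔ v) y :=
    (hu.1.and hv.1).mono fun y hy ↦ hy.1.sup hy.2
  rcases le_total (u x) (v x) with hle | hle
  · exact hv.of_le hcont (sup_eq_right.2 hle) (.of_forall fun y ↦ le_sup_right)
  · exact hu.of_le hcont (sup_eq_left.2 hle) (.of_forall fun y ↦ le_sup_left)

end Subharmonic

section Harmonic

variable {X : Type*} [TopologicalSpace X] [ChartedSpace ℂ X]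
  {φ : OpenPartialHomeomorph X ℂ} {W : Set X} {x : X} {u h : X → ℝ}

lemma IsHarmonicAt.neg (hh : IsHarmonicAt h x) : IsHarmonicAt (-h) x :=
  fun φ hφ hx ↦ (hh φ hφ hx).neg

lemma IsHarmonicAt.add (hu : IsHarmonicAt u x) (hh : IsHarmonicAt h x) :
    IsHarmonicAt (u + h) x :=
  fun φ hφ hx ↦ (hu φ hφ hx).add (hh φ hφ hx)

lemma IsHarmonicAt.const_smul (c : ℝ) (hh : IsHarmonicAt h x) : IsHarmonicAt (c • h) x :=
  fun φ hφ hx ↦ (hh φ hφ hx).const_smul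

lemma isHarmonicAt_const (c : ℝ) : IsHarmonicAt (fun _ : X ↦ c) x :=
  fun _ _ _ ↦ harmonicAt_const c

lemma IsHarmonicAt.congr (hh : IsHarmonicAt h x) (huh : u =ᶠ[𝓝 x] h) : IsHarmonicAt u x :=
  fun φ hφ hx ↦ by
    refine (harmonicAt_congr_nhds ?_).2 (hh φ hφ hx)
    exact (tendsto_symm_of_mem_source hx).eventually huh

lemma IsHolomorphicChart.isHarmonicAt_comp {f : ℂ → ℝ} (hφ : IsHolomorphicChart φ)
    (hx : x ∈ φ.source) (hf : HarmonicAt f (φ x)) : IsHarmonicAt (f ∘ φ) x := by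
  intro ψ hψ hxψ
  have hanalytic := hφ.analyticAt_comp_symm hψ (ψ.map_source hxψ) (by rwa [ψ.left_inv hxψ])
  refine harmonicAt_comp_of_analyticAt (p := φ ∘ ψ.symm) ?_ hanalytic
  simpa [ψ.left_inv hxψ] using hf

lemma IsHolomorphicChart.isHarmonicAt_log_norm_sub (hφ : IsHolomorphicChart φ)
    (hx : x ∈ φ.source) {c : ℂ} (hc : φ x ≠ c) :
    IsHarmonicAt (fun y ↦ Real.log ‖φ y - c‖) x :=
  hφ.isHarmonicAt_comp (f := fun z ↦ Real.log ‖z - c‖) hx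
    (AnalyticAt.harmonicAt_log_norm (f := fun z ↦ z - c) (by fun_prop) (sub_ne_zero.2 hc))

lemma IsHolomorphicChart.isHarmonicAt_log_norm (hφ : IsHolomorphicChart φ)
    (hx : x ∈ φ.source) (hx0 : φ x ≠ 0) : IsHarmonicAt (fun y ↦ Real.log ‖φ y‖) x := by
  simpa only [sub_zero] using hφ.isHarmonicAt_log_norm_sub hx hx0

lemma IsHolomorphicChart.isHarmonicAt_iff (hφ : IsHolomorphicChart φ) (hx : x ∈ φ.source) :
    IsHarmonicAt h x ↔ HarmonicAt (h ∘ φ.symm) (φ x) := by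
  refine ⟨fun hh ↦ hh φ hφ hx, fun hh ↦ (hφ.isHarmonicAt_comp hx hh).congr ?_⟩
  filter_upwards [φ.open_source.mem_nhds hx] with y hy
  simp [φ.left_inv hy]

variable [IsManifold 𝓘(ℂ) ω X]

lemma IsHarmonicAt.continuousAt (hh : IsHarmonicAt h x) : ContinuousAt h x := by
  have hx := mem_chart_source ℂ x
  have hcont := (hh _ (isHolomorphicChart_chartAt x) hx).1.continuousAt.comp
    ((chartAt ℂ x).continuousAt hx)
  refine hcont.congr ?_
  filter_upwards [(chartAt ℂ x).open_source.mem_nhds hx] with y hy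
  simp [(chartAt ℂ x).left_inv hy]

lemma IsHarmonicAt.eventually (hh : IsHarmonicAt h x) : ∀ᶠ y in 𝓝 x, IsHarmonicAt h y := by
  have hx := mem_chart_source ℂ x
  have hchart := isHolomorphicChart_chartAt x
  filter_upwards [((chartAt ℂ x).continuousAt hx).eventually (hh _ hchart hx).eventually,
    (chartAt ℂ x).open_source.mem_nhds hx] with y hy hyx
  exact (hchart.isHarmonicAt_iff hyx).2 hy

lemma IsHarmonicAt.isSubharmonicAt (hh : IsHarmonicAt h x) : IsSubharmonicAt h x := by
  refine ⟨hh.eventually.mono fun y hy ↦ hy.continuousAt, fun φ hφ hx ↦ ?_⟩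
  filter_upwards [eventually_forall_closedBall_of_eventually hh.eventually hx] with r ⟨hr, hball⟩
  have hharm : HarmonicOnNhd (h ∘ φ.symm) (closedBall (φ x) |r|) := fun z hz ↦ by
    obtain ⟨hzφ, hhz⟩ := hball z (abs_of_pos hr ▸ hz)
    simpa [φ.right_inv hzφ] using hhz φ hφ (φ.map_target hzφ)
  rw [hharm.circleAverage_eq, Function.comp_apply, φ.left_inv hx]

lemma isHarmonicOn_of_forall_isHarmonicAt (hh : ∀ x ∈ W, IsHarmonicAt h x) : IsHarmonicOn h W := by
  refine ⟨fun x hx ↦ (hh x hx).continuousAt.continuousWithinAt, fun φ hφ hφW hb ↦ ?_⟩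
  refine InnerProductSpace.HarmonicOnNhd.circleAverage_eq (f := h ∘ φ.symm) fun z hz ↦ ?_
  have hzφ : z ∈ φ.target := hb (by simpa using hz)
  simpa [φ.right_inv hzφ] using hh _ (hφW (φ.map_target hzφ)) φ hφ (φ.map_target hzφ)

end Harmonic

/-! ### The maximum principle -/

lemma eqOn_sphere_of_le_circleAverage {f : ℂ → ℝ} {c : ℂ} {r m : ℝ} (hr : 0 ≤ r)
    (hf : ContinuousOn f (sphere c r)) (hle : ∀ z ∈ sphere c r, f z ≤ m)
    (hge : m ≤ circleAverage f c r) : ∀ z ∈ sphere c r, f z = m := by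
  intro z hz
  by_contra hne
  obtain ⟨θ, hθ, rfl⟩ : z ∈ circleMap c r '' Ioc 0 (2 * π) := by
    rwa [image_circleMap_Ioc, abs_of_nonneg hr]
  have hcont : Continuous fun θ ↦ f (circleMap c r θ) :=
    hf.comp_continuous (continuous_circleMap c r) fun θ ↦ circleMap_mem_sphere c hr θ
  have hintegral : ∫ θ in 0..2 * π, f (circleMap c r θ) < ∫ _ in 0..2 * π, m :=
    intervalIntegral.integral_lt_integral_of_continuousOn_of_le_of_exists_lt two_pi_pos
      hcont.continuousOn continuousOn_const (fun θ _ ↦ hle _ (circleMap_mem_sphere c hr θ))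
      ⟨θ, Ioc_subset_Icc_self hθ, (hle _ hz).lt_of_ne hne⟩
  have haverage : circleAverage f c r < circleAverage (fun _ ↦ m) c r :=
    mul_lt_mul_of_pos_left hintegral (inv_pos.2 two_pi_pos)
  rw [circleAverage_const] at haverage
  exact hge.not_gt haverage

section MaximumPrinciple

variable {X : Type*} [TopologicalSpace X] [ChartedSpace ℂ X] [IsManifold 𝓘(ℂ) ω X]
  {u h : X → ℝ} {S O : Set X} {x : X}

theorem IsSubharmonicAt.eventually_eq_of_isLocalMax (hu : IsSubharmonicAt u x)
    (hmax : IsLocalMax u x) : ∀ᶠ y in 𝓝 x, u y = u x := by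
  have hx := mem_chart_source ℂ x
  set φ := chartAt ℂ x
  obtain ⟨R, hR, hsmall⟩ := mem_nhdsGT_iff_exists_Ioo_subset.1
    ((hu.2 φ (isHolomorphicChart_chartAt x) hx).and
      (eventually_forall_closedBall_of_eventually (hmax.and hu.1) hx))
  filter_upwards [φ.open_source.mem_nhds hx,
    (φ.continuousAt hx).preimage_mem_nhds (ball_mem_nhds _ hR)] with y hy hyR
  rcases eq_or_ne y x with rfl | hyx
  · rfl
  obtain ⟨hmean, hpos, hball⟩ := hsmall ⟨dist_pos.2 fun heq ↦ hyx (φ.injOn hy hx heq), hyR⟩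
  have hball' := fun z hz ↦ hball z (sphere_subset_closedBall hz)
  have hcircle := eqOn_sphere_of_le_circleAverage (f := u ∘ φ.symm) hpos.le
    (fun z hz ↦ ((hball' z hz).2.2.comp (φ.continuousAt_symm (hball' z hz).1)).continuousWithinAt)
    (fun z hz ↦ (hball' z hz).2.1) hmean (φ y) rfl
  simpa [φ.left_inv hy] using hcircle

variable [T2Space X] [ConnectedSpace X]

theorem IsSubharmonicAt.le_const_of_isCompact {m : ℝ} (hS : IsCompact S) (hO : IsOpen O)
    (hOS : O ⊆ S) (hO_ne : O ≠ univ) (hu : ContinuousOn u S)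
    (hsub : ∀ x ∈ O, IsSubharmonicAt u x) (hm : ∀ x ∈ S \ O, u x ≤ m) : ∀ x ∈ S, u x ≤ m := by
  by_contra! ⟨x₀, hx₀S, hx₀⟩
  obtain ⟨x₁, hx₁S, hx₁⟩ := hS.exists_isMaxOn ⟨x₀, hx₀S⟩ hu
  set T := S ∩ u ⁻¹' {u x₁}
  have hTO : T ⊆ O := fun x hx ↦ by
    by_contra hxO
    exact ((hx₀.trans_le (hx₁ hx₀S)).trans_eq hx.2.symm).not_ge (hm x ⟨hx.1, hxO⟩)
  have hclosed : IsClosed T := hu.preimage_isClosed_of_isClosed hS.isClosed isClosed_singleton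
  have hopen : IsOpen T := isOpen_iff_mem_nhds.2 fun x hx ↦ by
    have hS_nhds : S ∈ 𝓝 x := mem_of_superset (hO.mem_nhds (hTO hx)) hOS
    have hmax : IsLocalMax u x := by
      filter_upwards [hS_nhds] with y hy using (hx₁ hy).trans_eq hx.2.symm
    filter_upwards [hS_nhds, (hsub x (hTO hx)).eventually_eq_of_isLocalMax hmax] with y hyS hy
    exact ⟨hyS, hy.trans hx.2⟩
  have huniv : T = univ := IsClopen.eq_univ ⟨hclosed, hopen⟩ ⟨x₁, hx₁S, rfl⟩
  exact hO_ne (univ_subset_iff.1 (huniv ▸ hTO))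

theorem IsSubharmonicAt.le_of_isCompact (hS : IsCompact S) (hO : IsOpen O) (hOS : O ⊆ S)
    (hO_ne : O ≠ univ) (hu : ContinuousOn u S) (hh : ContinuousOn h S)
    (hsub : ∀ x ∈ O, IsSubharmonicAt u x) (hharm : ∀ x ∈ O, IsHarmonicAt h x)
    (hle : ∀ x ∈ S \ O, u x ≤ h x) : ∀ x ∈ S, u x ≤ h x := by
  intro x hx
  have hdiff : (u + -h) x ≤ 0 := IsSubharmonicAt.le_const_of_isCompact hS hO hOS hO_ne
    (hu.add hh.neg) (fun y hy ↦ (hsub y hy).add (hharm y hy).neg.isSubharmonicAt)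
    (fun y hy ↦ by simpa using hle y hy) x hx
  simpa using hdiff

end MaximumPrinciple

/-! ### Poisson modification -/

open Classical in
/-- The Poisson modification of `v` in the coordinate disk `φ`: the values of `v` in the open disk
are replaced by the Poisson integral of its values on the boundary circle. -/
noncomputable def poissonModification {X : Type*} [TopologicalSpace X]
    (φ : OpenPartialHomeomorph X ℂ) (v : X → ℝ) (x : X) : ℝ :=
  if x ∈ chartPreimage φ (ball 0 1) then poissonIntegral (v ∘ φ.symm) 0 1 (φ x) else v x

section PoissonModification

variable {X : Type*} [TopologicalSpace X] {φ : OpenPartialHomeomorph X ℂ} {u v : X → ℝ} {x : X}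

lemma poissonModification_of_mem (hx : x ∈ chartPreimage φ (ball 0 1)) :
    poissonModification φ v x = poissonIntegral (v ∘ φ.symm) 0 1 (φ x) :=
  if_pos hx

lemma poissonModification_of_notMem (hx : x ∉ chartPreimage φ (ball 0 1)) :
    poissonModification φ v x = v x :=
  if_neg hx

lemma poissonModification_neg : poissonModification φ (-v) = -poissonModification φ v := by
  ext x
  by_cases hx : x ∈ chartPreimage φ (ball 0 1)
  · rw [Pi.neg_apply, poissonModification_of_mem hx, poissonModification_of_mem hx,
      ← poissonIntegral_neg]
    rfl
  · simp only [Pi.neg_apply, poissonModification_of_notMem hx]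

variable [ChartedSpace ℂ X]

lemma IsCoordinateDisk.zero_mem_target (hφ : IsCoordinateDisk φ) : (0 : ℂ) ∈ φ.target :=
  hφ.closedBall_subset (mem_closedBall_self zero_le_one)

lemma IsCoordinateDisk.isCompact_chartPreimage (hφ : IsCoordinateDisk φ) {s : Set ℂ}
    (hs : IsCompact s) (hs1 : s ⊆ closedBall 0 1) : IsCompact (chartPreimage φ s) :=
  _root_.isCompact_chartPreimage hs (hs1.trans hφ.closedBall_subset)

lemma IsCoordinateDisk.circleIntegrable_comp_symm (hφ : IsCoordinateDisk φ)
    (hv : ∀ x ∈ chartPreimage φ (sphere 0 1), ContinuousAt v x) :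
    CircleIntegrable (v ∘ φ.symm) 0 1 :=
  (continuousOn_comp_symm (sphere_subset_closedBall.trans hφ.closedBall_subset)
    hv).circleIntegrable zero_le_one

lemma IsCoordinateDisk.poissonModification_symm (hφ : IsCoordinateDisk φ) {w : ℂ}
    (hw : w ∈ ball (0 : ℂ) 1) :
    poissonModification φ v (φ.symm w) = poissonIntegral (v ∘ φ.symm) 0 1 w := by
  have hwt : w ∈ φ.target := hφ.closedBall_subset (ball_subset_closedBall hw)
  rw [poissonModification_of_mem (symm_mem_chartPreimage hwt hw), φ.right_inv hwt]

lemma IsCoordinateDisk.isHarmonicAt_poissonModification (hφ : IsCoordinateDisk φ)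
    (hv : ∀ x ∈ chartPreimage φ (sphere 0 1), ContinuousAt v x)
    (hx : x ∈ chartPreimage φ (ball 0 1)) : IsHarmonicAt (poissonModification φ v) x := by
  refine (hφ.isHolomorphicChart.isHarmonicAt_comp hx.1
    (harmonicAt_poissonIntegral (hφ.circleIntegrable_comp_symm hv) hx.2)).congr ?_
  filter_upwards [(isOpen_chartPreimage isOpen_ball).mem_nhds hx] with y hy
  exact poissonModification_of_mem hy

variable [T2Space X]

lemma IsCoordinateDisk.poissonModification_eventuallyEq (hφ : IsCoordinateDisk φ)
    (hx : x ∉ chartPreimage φ (closedBall 0 1)) : poissonModification φ v =ᶠ[𝓝 x] v := by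
  have hclosed := (hφ.isCompact_chartPreimage (isCompact_closedBall 0 1) subset_rfl).isClosed
  filter_upwards [hclosed.isOpen_compl.mem_nhds hx] with y hy
  exact poissonModification_of_notMem fun hyb ↦ hy (chartPreimage_mono ball_subset_closedBall hyb)

lemma IsCoordinateDisk.continuousAt_poissonModification (hφ : IsCoordinateDisk φ)
    (hv : ∀ x ∈ chartPreimage φ (sphere 0 1), ContinuousAt v x)
    (hx : x ∉ chartPreimage φ (ball 0 1)) (hvx : ContinuousAt v x) :
    ContinuousAt (poissonModification φ v) x := by
  by_cases hxc : x ∈ chartPreimage φ (closedBall 0 1)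
  swap
  · exact hvx.congr (hφ.poissonModification_eventuallyEq hxc).symm
  have hsphere : φ x ∈ sphere (0 : ℂ) 1 :=
    ((ball_union_sphere (x := (0 : ℂ)) (ε := 1)).ge hxc.2).resolve_left fun hb ↦ hx ⟨hxc.1, hb⟩
  have hmaps : Tendsto φ (𝓝[chartPreimage φ (ball 0 1)] x) (𝓝[ball 0 1] (φ x)) :=
    (φ.continuousAt hxc.1).continuousWithinAt.tendsto_nhdsWithin fun y hy ↦ hy.2
  have hinside : ContinuousWithinAt (poissonModification φ v) (chartPreimage φ (ball 0 1)) x := by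
    have hlim := (tendsto_poissonIntegral (continuousOn_comp_symm
      (sphere_subset_closedBall.trans hφ.closedBall_subset) hv) hsphere).comp hmaps
    rw [ContinuousWithinAt, poissonModification_of_notMem hx]
    refine Tendsto.congr' ?_ (by simpa [φ.left_inv hxc.1] using hlim)
    filter_upwards [self_mem_nhdsWithin] with y hy using (poissonModification_of_mem hy).symm
  have houtside : ContinuousWithinAt (poissonModification φ v) (chartPreimage φ (ball 0 1))ᶜ x :=
    hvx.continuousWithinAt.congr (fun y hy ↦ poissonModification_of_notMem hy)
      (poissonModification_of_notMem hx)
  rw [← continuousWithinAt_univ, ← union_compl_self (chartPreimage φ (ball 0 1))]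
  exact hinside.union houtside

variable [IsManifold 𝓘(ℂ) ω X]

lemma IsCoordinateDisk.continuousOn_poissonModification (hφ : IsCoordinateDisk φ)
    (hv : ∀ x ∈ chartPreimage φ (sphere 0 1), ContinuousAt v x) :
    ContinuousOn (poissonModification φ v) (chartPreimage φ (closedBall 0 1)) := by
  intro x hx
  by_cases hxb : x ∈ chartPreimage φ (ball 0 1)
  · exact (hφ.isHarmonicAt_poissonModification hv hxb).continuousAt.continuousWithinAt
  · have hsphere : φ x ∈ sphere (0 : ℂ) 1 :=
      ((ball_union_sphere (x := (0 : ℂ)) (ε := 1)).ge hx.2).resolve_left fun hb ↦ hxb ⟨hx.1, hb⟩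
    exact (hφ.continuousAt_poissonModification hv hxb (hv x ⟨hx.1, hsphere⟩)).continuousWithinAt

variable [ConnectedSpace X]

theorem IsCoordinateDisk.le_poissonModification (hφ : IsCoordinateDisk φ)
    (hv : ∀ x ∈ chartPreimage φ (closedBall 0 1), IsSubharmonicAt v x) :
    v ≤ poissonModification φ v := by
  intro x
  by_cases hx : x ∈ chartPreimage φ (ball 0 1)
  swap
  · exact (poissonModification_of_notMem hx).ge
  have hsphere : ∀ x ∈ chartPreimage φ (sphere 0 1), ContinuousAt v x := fun x hx ↦
    (hv x (chartPreimage_mono sphere_subset_closedBall hx)).continuousAt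
  have hball := chartPreimage_mono (φ := φ) (ball_subset_closedBall (x := 0) (ε := 1))
  have hne : chartPreimage φ (ball 0 1) ≠ univ :=
    chartPreimage_ne_univ (z := 1) (hφ.closedBall_subset (by simp)) (by simp)
  exact IsSubharmonicAt.le_of_isCompact
    (hφ.isCompact_chartPreimage (isCompact_closedBall 0 1) subset_rfl)
    (isOpen_chartPreimage isOpen_ball) hball hne
    (fun y hy ↦ (hv y hy).continuousAt.continuousWithinAt)
    (hφ.continuousOn_poissonModification hsphere) (fun y hy ↦ hv y (hball hy))
    (fun y hy ↦ hφ.isHarmonicAt_poissonModification hsphere hy)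
    (fun y hy ↦ (poissonModification_of_notMem hy.2).ge) x (hball hx)

lemma IsSubharmonicAt.poissonModification (hφ : IsCoordinateDisk φ)
    (hv : ∀ x ∈ chartPreimage φ (closedBall 0 1), IsSubharmonicAt v x)
    (hx : IsSubharmonicAt v x) : IsSubharmonicAt (poissonModification φ v) x := by
  have hsphere : ∀ x ∈ chartPreimage φ (sphere 0 1), ContinuousAt v x := fun x hx ↦
    (hv x (chartPreimage_mono sphere_subset_closedBall hx)).continuousAt
  by_cases hxb : x ∈ chartPreimage φ (ball 0 1)
  · exact (hφ.isHarmonicAt_poissonModification hsphere hxb).isSubharmonicAt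
  refine hx.of_le ?_ (poissonModification_of_notMem hxb)
    (.of_forall (hφ.le_poissonModification hv))
  filter_upwards [hx.1] with y hy
  by_cases hyb : y ∈ chartPreimage φ (ball 0 1)
  · exact (hφ.isHarmonicAt_poissonModification hsphere hyb).continuousAt
  · exact hφ.continuousAt_poissonModification hsphere hyb hy

end PoissonModification

section HarmonicOn

variable {X : Type*} [TopologicalSpace X] [ChartedSpace ℂ X] {u : X → ℝ} {W : Set X} {x : X}

lemma IsHarmonicOn.neg (hu : IsHarmonicOn u W) : IsHarmonicOn (-u) W :=
  ⟨hu.1.neg, fun φ hφ hφW hb ↦ by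
    have hneg : (fun z ↦ (-u) (φ.symm z)) = (-1 : ℝ) • fun z ↦ u (φ.symm z) := by ext z; simp
    rw [hneg, circleAverage_smul, hu.2 φ hφ hφW hb]
    simp⟩

variable [IsManifold 𝓘(ℂ) ω X]

lemma IsHarmonicOn.isSubharmonicAt (hu : IsHarmonicOn u W) (hW : W ∈ 𝓝 x) :
    IsSubharmonicAt u x := by
  refine ⟨(eventually_mem_nhds_iff.2 hW).mono fun y hy ↦ hu.1.continuousAt hy, fun φ hφ hx ↦ ?_⟩
  filter_upwards [eventually_forall_closedBall_of_eventually (eventually_mem_nhds_iff.2 hW) hx]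
    with r ⟨hr, hball⟩
  obtain ⟨ψ, hψ, hsource, -, hψ_symm⟩ := hφ.exists_isCoordinateDisk_rescale hr isOpen_interior
    fun z hz ↦ ⟨(hball z hz).1, mem_interior_iff_mem_nhds.2 (hball z hz).2⟩
  have hmean := hu.2 ψ hψ.isHolomorphicChart
    (hsource.trans_subset (inter_subset_right.trans interior_subset)) hψ.closedBall_subset
  rw [circleAverage_eq_circleAverage_zero_one]
  exact (by simpa [hψ_symm, φ.left_inv hx] using hmean : _ = u x).ge

variable [T2Space X] [ConnectedSpace X]

theorem isHarmonicOn_iff_forall_isHarmonicAt (hW : IsOpen W) :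
    IsHarmonicOn u W ↔ ∀ x ∈ W, IsHarmonicAt u x := by
  refine ⟨fun hu x hx ↦ ?_, isHarmonicOn_of_forall_isHarmonicAt⟩
  obtain ⟨φ, hφ, hxφ, hφW, hφx⟩ := exists_isCoordinateDisk_centered (hW.mem_nhds hx)
  have hsub : ∀ {v : X → ℝ}, IsHarmonicOn v W → ∀ y ∈ chartPreimage φ (closedBall 0 1),
      IsSubharmonicAt v y := fun hv y hy ↦ hv.isSubharmonicAt (hW.mem_nhds (hφW hy.1))
  have hle_neg := hφ.le_poissonModification (hsub hu.neg)
  rw [poissonModification_neg] at hle_neg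
  have heq : u = poissonModification φ u :=
    le_antisymm (hφ.le_poissonModification (hsub hu)) (neg_le_neg_iff.1 hle_neg)
  rw [heq]
  exact hφ.isHarmonicAt_poissonModification
    (fun y hy ↦ (hsub hu y (chartPreimage_mono sphere_subset_closedBall hy)).continuousAt)
    ⟨hxφ, by simp [hφx]⟩

end HarmonicOn

/-! ### Isolated singularities -/

section Singularity

lemma eventually_forall_chartPreimage_sphere {X : Type*} [TopologicalSpace X]
    {φ : OpenPartialHomeomorph X ℂ} {P : X → Prop} (h0 : (0 : ℂ) ∈ φ.target)
    (hP : ∀ᶠ x in 𝓝[≠] (φ.symm 0), P x) :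
    ∀ᶠ r in 𝓝[>] (0 : ℝ), ∀ x ∈ chartPreimage φ (sphere 0 r), P x := by
  filter_upwards [eventually_forall_closedBall_of_eventually (eventually_nhdsWithin_iff.1 hP)
    (φ.map_target h0)] with r ⟨hr, hball⟩ x hx
  rw [φ.right_inv h0] at hball
  have hPx := (hball (φ x) (sphere_subset_closedBall hx.2)).2
  rw [φ.left_inv hx.1] at hPx
  exact hPx fun heq ↦ ne_of_mem_sphere hx.2 hr.ne' ((φ.eq_symm_apply hx.1 h0).1 heq)

variable {X : Type*} [TopologicalSpace X] [ChartedSpace ℂ X] [IsManifold 𝓘(ℂ) ω X] [T2Space X]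
  [ConnectedSpace X] {φ : OpenPartialHomeomorph X ℂ} {u : X → ℝ} {x : X} {m : ℝ}

lemma IsCoordinateDisk.le_sub_mul_log_of_annulus (hφ : IsCoordinateDisk φ) {a δ : ℝ} (hδ : 0 < δ)
    (hu : ContinuousOn u (chartPreimage φ (closedBall 0 1 \ ball 0 δ)))
    (hsub : ∀ x ∈ chartPreimage φ (ball 0 1 \ closedBall 0 δ), IsSubharmonicAt u x)
    (houter : ∀ x ∈ chartPreimage φ (sphere 0 1), u x ≤ m)
    (hinner : ∀ x ∈ chartPreimage φ (sphere 0 δ), u x ≤ m - a * Real.log δ) :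
    ∀ x ∈ chartPreimage φ (closedBall 0 1 \ ball 0 δ), u x ≤ m - a * Real.log ‖φ x‖ := by
  have hharm : ∀ x ∈ chartPreimage φ (closedBall 0 1 \ ball 0 δ),
      IsHarmonicAt ((fun _ ↦ m) + (-a) • fun x ↦ Real.log ‖φ x‖) x := fun x hx ↦
    (isHarmonicAt_const m).add ((hφ.isHolomorphicChart.isHarmonicAt_log_norm hx.1
      (by rintro h0; exact hx.2.2 (by simpa [h0] using hδ))).const_smul _)
  have hsubset : chartPreimage φ (ball 0 1 \ closedBall 0 δ) ⊆
      chartPreimage φ (closedBall 0 1 \ ball 0 δ) :=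
    chartPreimage_mono (sdiff_subset_sdiff ball_subset_closedBall ball_subset_closedBall)
  have hcompare := IsSubharmonicAt.le_of_isCompact
    (hφ.isCompact_chartPreimage ((isCompact_closedBall 0 1).diff isOpen_ball) sdiff_subset)
    (isOpen_chartPreimage (isOpen_ball.sdiff isClosed_closedBall)) hsubset
    (chartPreimage_ne_univ hφ.zero_mem_target (by simp [hδ.le])) hu
    (fun x hx ↦ (hharm x hx).continuousAt.continuousWithinAt) hsub
    (fun x hx ↦ hharm x (hsubset hx)) ?_
  · simpa [sub_eq_add_neg] using hcompare
  rintro x ⟨⟨hxφ, hx1, hxδ⟩, hxO⟩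
  rw [mem_closedBall_zero_iff] at hx1
  rw [mem_ball_zero_iff, not_lt] at hxδ
  rcases hx1.eq_or_lt with heq | hlt
  · simpa [heq] using houter x ⟨hxφ, by simpa using heq⟩
  · have heq : ‖φ x‖ = δ := hxδ.antisymm' <| by
      by_contra! hgt
      exact hxO ⟨hxφ, by simpa using hlt, by simpa using hgt⟩
    simpa [heq, sub_eq_add_neg] using hinner x ⟨hxφ, by simpa using heq⟩

theorem IsCoordinateDisk.le_of_punctured (hφ : IsCoordinateDisk φ)
    (hu : ContinuousOn u (chartPreimage φ (closedBall 0 1 \ {0})))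
    (hsub : ∀ x ∈ chartPreimage φ (ball 0 1 \ {0}), IsSubharmonicAt u x)
    (hbdd : IsBoundedUnder (· ≤ ·) (𝓝[≠] (φ.symm 0)) u)
    (hle : ∀ x ∈ chartPreimage φ (sphere 0 1), u x ≤ m) :
    ∀ x ∈ chartPreimage φ (closedBall 0 1 \ {0}), u x ≤ m := by
  intro x hx
  obtain ⟨M, hM⟩ := hbdd
  have hcompare : ∀ ε > 0, u x ≤ m - ε * Real.log ‖φ x‖ := by
    intro ε hε
    have hlog : Tendsto (fun δ ↦ M + ε * Real.log δ) (𝓝[>] 0) atBot :=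
      tendsto_atBot_add_const_left _ _ (tendsto_log_nhdsGT_zero.const_mul_atBot hε)
    obtain ⟨δ, hMδ, hδM, hδ, hδx⟩ := ((eventually_forall_chartPreimage_sphere
      hφ.zero_mem_target (eventually_map.1 hM)).and ((hlog.eventually_le_atBot m).and
      (Ioo_mem_nhdsGT (norm_pos_iff.2 hx.2.2)))).exists
    refine hφ.le_sub_mul_log_of_annulus hδ
      (hu.mono (chartPreimage_mono (sdiff_subset_sdiff_right (by simpa using hδ))))
      (fun y hy ↦ hsub y (chartPreimage_mono (sdiff_subset_sdiff_right (by simpa using hδ.le)) hy))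
      hle (fun y hy ↦ ?_) x ⟨hx.1, hx.2.1, by simpa using hδx.le⟩
    linarith [hMδ y hy]
  have hlim : Tendsto (fun ε ↦ m - ε * Real.log ‖φ x‖) (𝓝[>] 0) (𝓝 (m - 0 * Real.log ‖φ x‖)) :=
    (Continuous.tendsto (by fun_prop) 0).mono_left nhdsWithin_le_nhds
  rw [zero_mul, sub_zero] at hlim
  exact ge_of_tendsto hlim (eventually_mem_nhdsWithin.mono hcompare)

lemma IsCoordinateDisk.le_poissonModification_of_punctured (hφ : IsCoordinateDisk φ)
    (hsub : ∀ x ∈ chartPreimage φ (closedBall 0 1 \ {0}), IsSubharmonicAt u x)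
    (hbdd : IsBoundedUnder (· ≤ ·) (𝓝[≠] (φ.symm 0)) u) :
    ∀ x ∈ chartPreimage φ (closedBall 0 1 \ {0}), u x ≤ poissonModification φ u x := by
  have hsphere : ∀ x ∈ chartPreimage φ (sphere 0 1), ContinuousAt u x := fun x hx ↦
    (hsub x ⟨hx.1, sphere_subset_closedBall hx.2, ne_of_mem_sphere hx.2 one_ne_zero⟩).continuousAt
  have hharm : ∀ x ∈ chartPreimage φ (ball 0 1), IsHarmonicAt (-poissonModification φ u) x :=
    fun x hx ↦ (hφ.isHarmonicAt_poissonModification hsphere hx).neg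
  have hcont : ContinuousAt (-poissonModification φ u) (φ.symm 0) :=
    (hharm _ (symm_mem_chartPreimage hφ.zero_mem_target (by simp))).continuousAt
  have hdiff := hφ.le_of_punctured (u := u + -poissonModification φ u) (m := 0)
    (fun x hx ↦ (hsub x hx).continuousAt.continuousWithinAt.add
      ((hφ.continuousOn_poissonModification hsphere).neg.mono
        (chartPreimage_mono sdiff_subset) x hx))
    (fun x hx ↦ (hsub x ⟨hx.1, ball_subset_closedBall hx.2.1, hx.2.2⟩).add
      (hharm x ⟨hx.1, hx.2.1⟩).isSubharmonicAt)
    (isBoundedUnder_le_add hbdd (hcont.tendsto.isBoundedUnder_le.mono nhdsWithin_le_nhds))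
    fun x hx ↦ ?_
  · simpa using hdiff
  · have hx' : x ∉ chartPreimage φ (ball 0 1) := fun h ↦
      (mem_ball.1 h.2).ne (mem_sphere.1 hx.2)
    simp [poissonModification_of_notMem hx']

theorem exists_isHarmonicAt_eventuallyEq_of_isBoundedUnder
    (hu : ∀ᶠ y in 𝓝[≠] x, IsHarmonicAt u y)
    (hbdd : IsBoundedUnder (· ≤ ·) (𝓝[≠] x) u) (hbdd' : IsBoundedUnder (· ≥ ·) (𝓝[≠] x) u) :
    ∃ h, IsHarmonicAt h x ∧ h =ᶠ[𝓝[≠] x] u := by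
  obtain ⟨φ, hφ, hxφ, hφW, hφx⟩ :=
    exists_isCoordinateDisk_centered (eventually_nhdsWithin_iff.1 hu)
  obtain rfl : x = φ.symm 0 := (φ.eq_symm_apply hxφ hφ.zero_mem_target).2 hφx
  have hharm : ∀ y ∈ chartPreimage φ (closedBall 0 1 \ {0}), IsHarmonicAt u y := fun y hy ↦
    hφW hy.1 fun heq ↦ hy.2.2 ((φ.eq_symm_apply hy.1 hφ.zero_mem_target).1 heq)
  have hle := hφ.le_poissonModification_of_punctured
    (fun y hy ↦ (hharm y hy).isSubharmonicAt) hbdd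
  have hge := hφ.le_poissonModification_of_punctured (u := -u)
    (fun y hy ↦ (hharm y hy).neg.isSubharmonicAt) (isBoundedUnder_le_neg.2 hbdd')
  rw [poissonModification_neg] at hge
  have hcenter : φ.symm 0 ∈ chartPreimage φ (ball 0 1) :=
    symm_mem_chartPreimage hφ.zero_mem_target (by simp)
  refine ⟨poissonModification φ u, hφ.isHarmonicAt_poissonModification (fun y hy ↦ (hharm y
    ⟨hy.1, sphere_subset_closedBall hy.2, ne_of_mem_sphere hy.2 one_ne_zero⟩).continuousAt)
    hcenter, eventually_nhdsWithin_iff.2 ?_⟩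
  filter_upwards [(isOpen_chartPreimage isOpen_ball).mem_nhds hcenter] with y hy hne
  have hy' : y ∈ chartPreimage φ (closedBall 0 1 \ {0}) := ⟨hy.1, ball_subset_closedBall hy.2,
    fun h0 ↦ hne ((φ.eq_symm_apply hy.1 hφ.zero_mem_target).2 h0)⟩
  exact (neg_le_neg_iff.1 (hge y hy')).antisymm (hle y hy')

end Singularity

/-! ### Perron's method -/

section Perron

variable {X : Type*} [TopologicalSpace X] [ChartedSpace ℂ X]

/-- A family of functions to which Perron's method applies on `W`: a pointwise bounded family of
nonnegative subharmonic functions, stable under maxima and under Poisson modification. Its upper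
envelope, the function `sSup F`, is then harmonic on `W`. -/
structure IsPerronFamily (F : Set (X → ℝ)) (W : Set X) : Prop where
  nonempty : F.Nonempty
  isSubharmonicAt : ∀ v ∈ F, ∀ x ∈ W, IsSubharmonicAt v x
  nonneg : ∀ v ∈ F, ∀ x ∈ W, 0 ≤ v x
  bddAbove : ∀ x ∈ W, BddAbove (Function.eval x '' F)
  sup_mem : ∀ u ∈ F, ∀ v ∈ F, u ⊔ v ∈ F
  poissonModification_mem : ∀ φ : OpenPartialHomeomorph X ℂ, IsCoordinateDisk φ → φ.source ⊆ W →
    ∀ v ∈ F, poissonModification φ v ∈ F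

variable {F : Set (X → ℝ)} {W : Set X} {φ : OpenPartialHomeomorph X ℂ} {u v : X → ℝ} {w : ℂ}
  {x : X} {a : ℝ}

namespace IsPerronFamily

lemma le_sSup (hF : IsPerronFamily F W) (hv : v ∈ F) (hx : x ∈ W) : v x ≤ sSup F x := by
  rw [sSup_apply_eq_sSup_image]
  exact le_csSup (hF.bddAbove x hx) (mem_image_of_mem _ hv)

lemma sSup_le (hF : IsPerronFamily F W) (hle : ∀ v ∈ F, v x ≤ a) : sSup F x ≤ a := by
  rw [sSup_apply_eq_sSup_image]
  exact csSup_le (hF.nonempty.image _) (forall_mem_image.2 hle)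

lemma circleIntegrable_comp_symm (hF : IsPerronFamily F W) (hφ : IsCoordinateDisk φ)
    (hφW : φ.source ⊆ W) (hv : v ∈ F) : CircleIntegrable (v ∘ φ.symm) 0 1 :=
  hφ.circleIntegrable_comp_symm fun x hx ↦ (hF.isSubharmonicAt v hv x (hφW hx.1)).continuousAt

lemma poissonIntegral_le_sSup (hF : IsPerronFamily F W) (hφ : IsCoordinateDisk φ)
    (hφW : φ.source ⊆ W) (hv : v ∈ F) (hw : w ∈ ball (0 : ℂ) 1) :
    poissonIntegral (v ∘ φ.symm) 0 1 w ≤ sSup F (φ.symm w) := by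
  rw [← hφ.poissonModification_symm hw]
  exact hF.le_sSup (hF.poissonModification_mem φ hφ hφW v hv)
    (hφW (φ.map_target (hφ.closedBall_subset (ball_subset_closedBall hw))))

variable [IsManifold 𝓘(ℂ) ω X] [T2Space X] [ConnectedSpace X]

lemma le_poissonIntegral (hF : IsPerronFamily F W) (hφ : IsCoordinateDisk φ)
    (hφW : φ.source ⊆ W) (hv : v ∈ F) (hw : w ∈ ball (0 : ℂ) 1) :
    v (φ.symm w) ≤ poissonIntegral (v ∘ φ.symm) 0 1 w := by
  rw [← hφ.poissonModification_symm hw]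
  exact hφ.le_poissonModification (fun x hx ↦ hF.isSubharmonicAt v hv x (hφW hx.1)) _

theorem sSup_le_harnack (hF : IsPerronFamily F W) (hφ : IsCoordinateDisk φ)
    (hφW : φ.source ⊆ W) (hw : w ∈ ball (0 : ℂ) 1) :
    sSup F (φ.symm w) ≤ (1 + ‖w‖) / (1 - ‖w‖) * sSup F (φ.symm 0) := by
  have hratio : 0 ≤ (1 + ‖w‖) / (1 - ‖w‖) :=
    div_nonneg (by positivity) (sub_nonneg.2 (mem_ball_zero_iff.1 hw).le)
  refine hF.sSup_le fun v hv ↦ ?_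
  calc v (φ.symm w) ≤ poissonIntegral (v ∘ φ.symm) 0 1 w := hF.le_poissonIntegral hφ hφW hv hw
    _ ≤ (1 + ‖w‖) / (1 - ‖w‖) * poissonIntegral (v ∘ φ.symm) 0 1 0 := by
      simpa using poissonIntegral_le_harnack (hF.circleIntegrable_comp_symm hφ hφW hv) hw
        fun z hz ↦ hF.nonneg v hv _
          (hφW (φ.map_target (hφ.closedBall_subset (sphere_subset_closedBall hz))))
    _ ≤ (1 + ‖w‖) / (1 - ‖w‖) * sSup F (φ.symm 0) :=
      mul_le_mul_of_nonneg_left (hF.poissonIntegral_le_sSup hφ hφW hv (by simp)) hratio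

theorem harnack_le_sSup (hF : IsPerronFamily F W) (hφ : IsCoordinateDisk φ)
    (hφW : φ.source ⊆ W) (hw : w ∈ ball (0 : ℂ) 1) :
    (1 - ‖w‖) / (1 + ‖w‖) * sSup F (φ.symm 0) ≤ sSup F (φ.symm w) := by
  have hw1 : 0 < 1 - ‖w‖ := sub_pos.2 (mem_ball_zero_iff.1 hw)
  rw [← le_div_iff₀' (by positivity)]
  refine hF.sSup_le fun v hv ↦ ?_
  rw [le_div_iff₀' (by positivity)]
  calc (1 - ‖w‖) / (1 + ‖w‖) * v (φ.symm 0)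
      ≤ (1 - ‖w‖) / (1 + ‖w‖) * poissonIntegral (v ∘ φ.symm) 0 1 0 :=
        mul_le_mul_of_nonneg_left (hF.le_poissonIntegral hφ hφW hv (by simp)) (by positivity)
    _ ≤ poissonIntegral (v ∘ φ.symm) 0 1 w := by
      simpa using harnack_le_poissonIntegral (hF.circleIntegrable_comp_symm hφ hφW hv) hw
        fun z hz ↦ hF.nonneg v hv _
          (hφW (φ.map_target (hφ.closedBall_subset (sphere_subset_closedBall hz))))
    _ ≤ sSup F (φ.symm w) := hF.poissonIntegral_le_sSup hφ hφW hv hw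

lemma continuousAt_sSup (hF : IsPerronFamily F W) (hW : W ∈ 𝓝 x) :
    ContinuousAt (sSup F) x := by
  obtain ⟨φ, hφ, hxφ, hφW, hφx⟩ := exists_isCoordinateDisk_centered hW
  have hx : φ.symm 0 = x := by rw [← hφx, φ.left_inv hxφ]
  have hnorm : Tendsto (fun y ↦ ‖φ y‖) (𝓝 x) (𝓝 0) := by
    simpa [hφx] using (φ.continuousAt hxφ).norm.tendsto
  have hlower : Tendsto (fun y ↦ (1 - ‖φ y‖) / (1 + ‖φ y‖) * sSup F x) (𝓝 x) (𝓝 (sSup F x)) := by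
    simpa using ((hnorm.const_sub 1).div (hnorm.const_add 1) (by simp)).mul_const (sSup F x)
  have hupper : Tendsto (fun y ↦ (1 + ‖φ y‖) / (1 - ‖φ y‖) * sSup F x) (𝓝 x) (𝓝 (sSup F x)) := by
    simpa using ((hnorm.const_add 1).div (hnorm.const_sub 1) (by simp)).mul_const (sSup F x)
  refine tendsto_of_tendsto_of_tendsto_of_le_of_le' hlower hupper ?_ ?_ <;>
    filter_upwards [φ.open_source.mem_nhds hxφ, hnorm.eventually (gt_mem_nhds one_pos)]
      with y hyφ hy
  · simpa [hx, φ.left_inv hyφ] using hF.harnack_le_sSup hφ hφW (mem_ball_zero_iff.2 hy)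
  · simpa [hx, φ.left_inv hyφ] using hF.sSup_le_harnack hφ hφW (mem_ball_zero_iff.2 hy)

lemma exists_forall_sSup_lt_add (hF : IsPerronFamily F W) (hW : IsOpen W) {K : Set X}
    (hK : IsCompact K) (hKW : K ⊆ W) {ε : ℝ} (hε : 0 < ε) :
    ∃ v ∈ F, ∀ x ∈ K, sSup F x < v x + ε := by
  have : Nonempty F := hF.nonempty.to_subtype
  have : IsDirectedOrder F := ⟨fun u v ↦ ⟨⟨u ⊔ v, hF.sup_mem u u.2 v v.2⟩,
    Subtype.coe_le_coe.1 le_sup_left, Subtype.coe_le_coe.1 le_sup_right⟩⟩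
  have hmono : ∀ x ∈ K, Monotone fun v : F ↦ (v : X → ℝ) x := fun x _ u v huv ↦ huv x
  have hdini := Monotone.tendstoUniformlyOn_of_forall_tendsto
    (F := fun v : F ↦ (v : X → ℝ)) (f := sSup F) hK
    (fun v x hx ↦ (hF.isSubharmonicAt v v.2 x (hKW hx)).continuousAt.continuousWithinAt) hmono
    (fun x hx ↦ (hF.continuousAt_sSup (hW.mem_nhds (hKW hx))).continuousWithinAt) fun x hx ↦ ?_
  · obtain ⟨v, hv⟩ := (Metric.tendstoUniformlyOn_iff.1 hdini ε hε).exists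
    exact ⟨v, v.2, fun x hx ↦ sub_lt_iff_lt_add'.1 ((le_abs_self _).trans_lt (hv x hx))⟩
  · rw [sSup_apply]
    refine tendsto_atTop_ciSup (hmono x hx) ?_
    simpa [image_eq_range] using hF.bddAbove x (hKW hx)

theorem isHarmonicAt_sSup (hF : IsPerronFamily F W) (hW : IsOpen W) (hx : x ∈ W) :
    IsHarmonicAt (sSup F) x := by
  obtain ⟨φ, hφ, hxφ, hφW, hφx⟩ := exists_isCoordinateDisk_centered (hW.mem_nhds hx)
  have hcont : ∀ y ∈ chartPreimage φ (sphere 0 1), ContinuousAt (sSup F) y := fun y hy ↦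
    hF.continuousAt_sSup (hW.mem_nhds (hφW hy.1))
  have hint := hφ.circleIntegrable_comp_symm hcont
  have hclose : ∀ w ∈ ball (0 : ℂ) 1, ∀ ε > 0,
      poissonIntegral (sSup F ∘ φ.symm) 0 1 w ≤ sSup F (φ.symm w) + ε ∧
      sSup F (φ.symm w) ≤ poissonIntegral (sSup F ∘ φ.symm) 0 1 w + ε := by
    intro w hw ε hε
    obtain ⟨v, hv, hvε⟩ := hF.exists_forall_sSup_lt_add hW
      (hφ.isCompact_chartPreimage (isCompact_closedBall 0 1) subset_rfl)
      (fun y hy ↦ hφW hy.1) hε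
    have hmem : ∀ z ∈ closedBall (0 : ℂ) 1, φ.symm z ∈ chartPreimage φ (closedBall 0 1) :=
      fun z hz ↦ symm_mem_chartPreimage (hφ.closedBall_subset hz) hz
    have hv_int := hF.circleIntegrable_comp_symm hφ hφW hv
    have hupper := poissonIntegral_mono hint (hv_int.add (circleIntegrable_const ε 0 1)) hw
      fun z hz ↦ (hvε _ (hmem z (sphere_subset_closedBall hz))).le
    have hlower := poissonIntegral_mono hv_int hint hw fun z hz ↦
      hF.le_sSup hv (hφW (hmem z (sphere_subset_closedBall hz)).1)
    rw [poissonIntegral_add hv_int (circleIntegrable_const ε 0 1) hw,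
      poissonIntegral_const ε hw] at hupper
    constructor
    · linarith [hF.poissonIntegral_le_sSup hφ hφW hv hw]
    · linarith [hF.le_poissonIntegral hφ hφW hv hw, hvε _ (hmem w (ball_subset_closedBall hw))]
  have hball : x ∈ chartPreimage φ (ball 0 1) := ⟨hxφ, by simp [hφx]⟩
  refine (hφ.isHarmonicAt_poissonModification hcont hball).congr ?_
  filter_upwards [(isOpen_chartPreimage isOpen_ball).mem_nhds hball] with y hy
  rw [poissonModification_of_mem hy, ← φ.left_inv hy.1, φ.right_inv (φ.map_source hy.1)]
  exact le_antisymm (le_of_forall_pos_le_add fun ε hε ↦ (hclose _ hy.2 ε hε).2)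
    (le_of_forall_pos_le_add fun ε hε ↦ (hclose _ hy.2 ε hε).1)

end IsPerronFamily

end Perron

/-! ### Propagation of strict bounds -/

section Gap

lemma isPreconnected_closedBall_sdiff_closedBall {a b : ℝ} (ha : 0 ≤ a) :
    IsPreconnected (closedBall (0 : ℂ) b \ closedBall 0 a) := by
  have hpolar : closedBall (0 : ℂ) b \ closedBall 0 a =
      (fun p : ℝ × ℝ ↦ circleMap 0 p.1 p.2) '' (Ioc a b ×ˢ univ) := by
    ext z
    simp only [Set.mem_sdiff, mem_closedBall_zero_iff, not_le, mem_image, mem_prod, mem_Ioc,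
      mem_univ, and_true, Prod.exists]
    constructor
    · rintro ⟨hzb, haz⟩
      exact ⟨‖z‖, z.arg, ⟨haz, hzb⟩, by simp [circleMap, norm_mul_exp_arg_mul_I]⟩
    · rintro ⟨s, t, ⟨has, hsb⟩, rfl⟩
      rw [norm_circleMap_zero, abs_of_pos (ha.trans_lt has)]
      exact ⟨hsb, has⟩
  rw [hpolar]
  refine ((convex_Ioc a b).isPreconnected.prod isPreconnected_univ).image _ ?_
  simp only [circleMap]
  fun_prop

lemma exists_continuous_circleAverage_lt_one {c ζ : ℂ} {R δ θ : ℝ} (hζ : ζ ∈ sphere c R)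
    (hδ : 0 < δ) (hθ : θ < 1) :
    ∃ g : ℂ → ℝ, Continuous g ∧ (∀ z, θ ≤ g z) ∧ (∀ z ∉ closedBall ζ δ, 1 ≤ g z) ∧
      circleAverage g c R < 1 := by
  have hR : 0 ≤ R := (mem_sphere.1 hζ) ▸ dist_nonneg
  let g : ℂ → ℝ := fun z ↦ min 1 (θ + (1 - θ) * (dist z ζ / δ))
  have hg : Continuous g := by fun_prop
  have hgζ : g ζ = θ := by simpa [g] using hθ.le
  refine ⟨g, hg, fun z ↦ le_min hθ.le ?_, fun z hz ↦ le_min le_rfl ?_, ?_⟩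
  · exact le_add_of_nonneg_right (mul_nonneg (sub_nonneg.2 hθ.le) (by positivity))
  · have hdist : 1 ≤ dist z ζ / δ := (one_le_div hδ).2 (by simpa using hz : δ < dist z ζ).le
    linarith [mul_le_mul_of_nonneg_left hdist (sub_nonneg.2 hθ.le)]
  · by_contra! hge
    have := eqOn_sphere_of_le_circleAverage hR hg.continuousOn (fun z _ ↦ min_le_left _ _) hge ζ hζ
    exact hθ.ne (hgζ ▸ this)

variable {X : Type*} [TopologicalSpace X]

/-- The points near which all functions of the family `V` are bounded by a common constant that is
strictly less than `1`. -/
def gapLocus (V : Set (X → ℝ)) : Set X :=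
  {x | ∃ θ < 1, ∀ᶠ y in 𝓝 x, ∀ v ∈ V, v y ≤ θ}

variable {V : Set (X → ℝ)} {φ : OpenPartialHomeomorph X ℂ} {x y : X} {r : ℝ}

lemma isOpen_gapLocus : IsOpen (gapLocus V) :=
  isOpen_iff_mem_nhds.2 fun _ ⟨θ, hθ, hx⟩ ↦ hx.eventually_nhds.mono fun _ hy ↦ ⟨θ, hθ, hy⟩

lemma exists_forall_le_lt_one_of_isCompact {K : Set X} (hK : IsCompact K)
    (hKV : K ⊆ gapLocus V) : ∃ θ < 1, ∀ v ∈ V, ∀ x ∈ K, v x ≤ θ := by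
  refine hK.induction_on ⟨0, one_pos, by simp⟩
    (fun s t hst ⟨θ, hθ, ht⟩ ↦ ⟨θ, hθ, fun v hv y hy ↦ ht v hv y (hst hy)⟩) ?_ ?_
  · rintro s t ⟨θ, hθ, hs⟩ ⟨θ', hθ', ht⟩
    refine ⟨max θ θ', max_lt hθ hθ', fun v hv y hy ↦ ?_⟩
    exact hy.elim (fun hy ↦ (hs v hv y hy).trans (le_max_left _ _))
      fun hy ↦ (ht v hv y hy).trans (le_max_right _ _)
  · intro x hx
    obtain ⟨θ, hθ, hnear⟩ := hKV hx
    exact ⟨_, mem_nhdsWithin_of_mem_nhds hnear, θ, hθ, fun v hv y hy ↦ hy v hv⟩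

variable [ChartedSpace ℂ X] [IsManifold 𝓘(ℂ) ω X] [T2Space X] [ConnectedSpace X]

lemma IsCoordinateDisk.symm_zero_mem_gapLocus (hφ : IsCoordinateDisk φ)
    (hsub : ∀ v ∈ V, ∀ x ∈ chartPreimage φ (closedBall 0 1), IsSubharmonicAt v x)
    (hle : ∀ v ∈ V, ∀ x ∈ chartPreimage φ (sphere 0 1), v x ≤ 1)
    (hy : y ∈ chartPreimage φ (sphere 0 1)) (hyV : y ∈ gapLocus V) :
    φ.symm 0 ∈ gapLocus V := by
  obtain ⟨θ, hθ, hnear⟩ := hyV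
  obtain ⟨δ, hδ, hball⟩ := (eventually_forall_closedBall_of_eventually hnear hy.1).exists
  obtain ⟨g, hg, hθg, hg_one, hg_avg⟩ := exists_continuous_circleAverage_lt_one hy.2 hδ hθ
  have hint : CircleIntegrable g 0 1 := hg.continuousOn.circleIntegrable zero_le_one
  have hvg : ∀ v ∈ V, ∀ z ∈ sphere (0 : ℂ) 1, v (φ.symm z) ≤ g z := by
    intro v hv z hz
    by_cases hzδ : z ∈ closedBall (φ y) δ
    · exact ((hball z hzδ).2 v hv).trans (hθg z)
    · exact (hle v hv _ (symm_mem_chartPreimage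
        (hφ.closedBall_subset (sphere_subset_closedBall hz)) hz)).trans (hg_one z hzδ)
  have hcenter : φ.symm 0 ∈ chartPreimage φ (ball 0 1) :=
    symm_mem_chartPreimage hφ.zero_mem_target (by simp)
  have hcont : ContinuousAt (fun x ↦ poissonIntegral g 0 1 (φ x)) (φ.symm 0) :=
    (hφ.isHolomorphicChart.isHarmonicAt_comp hcenter.1
      (harmonicAt_poissonIntegral hint hcenter.2)).continuousAt
  obtain ⟨θ', hgθ', hθ'⟩ := exists_between hg_avg
  have hcenter_lt : poissonIntegral g 0 1 (φ (φ.symm 0)) < θ' := by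
    rwa [φ.right_inv hφ.zero_mem_target, poissonIntegral_center one_ne_zero]
  refine ⟨θ', hθ', ?_⟩
  filter_upwards [(isOpen_chartPreimage isOpen_ball).mem_nhds hcenter,
    hcont.eventually (gt_mem_nhds hcenter_lt)] with x hx hlt v hv
  calc v x ≤ poissonModification φ v x := hφ.le_poissonModification (hsub v hv) x
    _ = poissonIntegral (v ∘ φ.symm) 0 1 (φ x) := poissonModification_of_mem hx
    _ ≤ poissonIntegral g 0 1 (φ x) :=
      poissonIntegral_mono (hφ.circleIntegrable_comp_symm fun x hx ↦
        (hsub v hv x (chartPreimage_mono sphere_subset_closedBall hx)).continuousAt) hint hx.2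
        (hvg v hv)
    _ ≤ θ' := hlt.le

lemma mem_gapLocus_of_mem_closure (hx : x ∈ closure (gapLocus V))
    (hV : ∀ᶠ y in 𝓝 x, ∀ v ∈ V, IsSubharmonicAt v y ∧ v y ≤ 1) : x ∈ gapLocus V := by
  obtain ⟨ψ, hψ, hxψ, hψV, hψx⟩ := exists_isCoordinateDisk_centered hV
  obtain ⟨y, ⟨hyψ, hy1⟩, hyV⟩ := mem_closure_iff.1 hx (chartPreimage ψ (ball 0 1))
    (isOpen_chartPreimage isOpen_ball) ⟨hxψ, by simp [hψx]⟩
  rcases eq_or_ne y x with rfl | hne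
  · exact hyV
  have hpos : 0 < ‖ψ y‖ := norm_pos_iff.2 fun h0 ↦ hne (ψ.injOn hyψ hxψ (h0.trans hψx.symm))
  obtain ⟨χ, hχ, hsource, hχψ, hχ_symm⟩ := hψ.isHolomorphicChart.exists_isCoordinateDisk_rescale
    hpos isOpen_univ fun z hz ↦ ⟨hψ.closedBall_subset
      (closedBall_subset_closedBall (mem_ball_zero_iff.1 hy1).le hz), mem_univ _⟩
  rw [inter_univ] at hsource
  have hgap := hχ.symm_zero_mem_gapLocus (V := V) (y := y)
    (fun v hv z hz ↦ (hψV (hsource ▸ hz.1) v hv).1)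
    (fun v hv z hz ↦ (hψV (hsource ▸ hz.1) v hv).2)
    ⟨hsource ▸ hyψ, by simp [hχψ, hpos.ne']⟩ hyV
  rwa [hχ_symm, mul_zero, add_zero, ← hψx, ψ.left_inv hxψ] at hgap

theorem IsCoordinateDisk.exists_forall_sphere_le_lt_one (hφ : IsCoordinateDisk φ) (hr : 0 ≤ r)
    (hr1 : r < 1) (hV : ∀ x ∉ chartPreimage φ (closedBall 0 r), ∀ v ∈ V,
      IsSubharmonicAt v x ∧ v x ≤ 1)
    (hgap : (gapLocus V \ chartPreimage φ (closedBall 0 r)).Nonempty) :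
    ∃ θ < 1, ∀ v ∈ V, ∀ x ∈ chartPreimage φ (sphere 0 1), v x ≤ θ := by
  set B := chartPreimage φ (closedBall 0 r)
  have hr_ball : closedBall (0 : ℂ) r ⊆ ball 0 1 := closedBall_subset_ball hr1
  have hB : IsClosed B := (hφ.isCompact_chartPreimage (isCompact_closedBall 0 r)
    (hr_ball.trans ball_subset_closedBall)).isClosed
  have hclosure : ∀ x ∈ closure (gapLocus V), x ∉ B → x ∈ gapLocus V := fun x hx hxB ↦
    mem_gapLocus_of_mem_closure hx
      (mem_of_superset (hB.isOpen_compl.mem_nhds hxB) hV)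
  have hopen : IsOpen (gapLocus V \ B) := isOpen_gapLocus.sdiff hB
  obtain ⟨z, hz⟩ : (frontier (gapLocus V \ B)).Nonempty := by
    rw [nonempty_iff_ne_empty, Ne, ← isClopen_iff_frontier_eq_empty, isClopen_iff]
    rintro (hempty | huniv)
    · exact hgap.ne_empty hempty
    · exact (huniv.ge (mem_univ (φ.symm 0))).2
        (symm_mem_chartPreimage hφ.zero_mem_target (mem_closedBall_self hr))
  rw [hopen.frontier_eq] at hz
  have hzB : z ∈ B := by
    by_contra hzB
    exact hz.2 ⟨hclosure z (closure_mono sdiff_subset hz.1) hzB, hzB⟩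
  obtain ⟨y, hy, hyV, hyB⟩ := mem_closure_iff.1 hz.1 (chartPreimage φ (ball 0 1))
    (isOpen_chartPreimage isOpen_ball) ⟨hzB.1, hr_ball hzB.2⟩
  have hannulus : chartPreimage φ (closedBall 0 1 \ closedBall 0 r) ⊆ gapLocus V := by
    have hconn : IsPreconnected (chartPreimage φ (closedBall 0 1 \ closedBall 0 r)) := by
      have htarget : closedBall (0 : ℂ) 1 \ closedBall 0 r ⊆ φ.target :=
        sdiff_subset.trans hφ.closedBall_subset
      rw [chartPreimage, ← φ.symm_image_eq_source_inter_preimage htarget]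
      exact (isPreconnected_closedBall_sdiff_closedBall hr).image _
        (φ.continuousOn_symm.mono htarget)
    refine hconn.subset_of_closure_inter_subset isOpen_gapLocus
      ⟨y, ⟨hy.1, ball_subset_closedBall hy.2, fun h ↦ hyB ⟨hy.1, h⟩⟩, hyV⟩
      fun x hx ↦ hclosure x hx.1 fun hxB ↦ hx.2.2.2 hxB.2
  exact exists_forall_le_lt_one_of_isCompact
    (hφ.isCompact_chartPreimage (isCompact_sphere 0 1) sphere_subset_closedBall)
    fun x hx ↦ hannulus ⟨hx.1, sphere_subset_closedBall hx.2,
      fun h ↦ (hr_ball h).ne (mem_sphere.1 hx.2)⟩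

end Gap

/-! ### The Green function -/

/-- The competitors for the Green function of `Y` with pole at the centre of the coordinate disk
`φ`: nonnegative functions that vanish outside a compact set and outside `Y`, are subharmonic away
from the pole, and grow at most like `-log ‖φ‖` at the pole. -/
structure IsGreenMinorant {X : Type*} [TopologicalSpace X] [ChartedSpace ℂ X]
    (φ : OpenPartialHomeomorph X ℂ) (Y : Set X) (v : X → ℝ) : Prop where
  nonneg : ∀ x, 0 ≤ v x
  eq_zero : ∀ x ∉ Y, v x = 0
  hasCompactSupport : HasCompactSupport v
  isSubharmonicAt : ∀ x ≠ φ.symm 0, IsSubharmonicAt v x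
  isBoundedUnder : IsBoundedUnder (· ≤ ·) (𝓝[≠] (φ.symm 0)) fun x ↦ v x + Real.log ‖φ x‖

/-- The Green function of `Y` with pole at the centre of the coordinate disk `φ`, as the upper
envelope of its competitors; its value at the pole is irrelevant. -/
noncomputable def greenFunction {X : Type*} [TopologicalSpace X] [ChartedSpace ℂ X]
    (φ : OpenPartialHomeomorph X ℂ) (Y : Set X) : X → ℝ :=
  sSup {v | IsGreenMinorant φ Y v}

/-- The Green function of the unit disk in the coordinate `φ`, extended by zero. -/
noncomputable def diskGreen {X : Type*} [TopologicalSpace X] (φ : OpenPartialHomeomorph X ℂ) :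
    X → ℝ :=
  φ.source.indicator fun x ↦ max (-Real.log ‖φ x‖) 0

section GreenMinorant

variable {X : Type*} [TopologicalSpace X] {φ ψ : OpenPartialHomeomorph X ℂ} {Y : Set X}
  {u v : X → ℝ} {x : X}

lemma diskGreen_nonneg : 0 ≤ diskGreen φ :=
  Set.indicator_nonneg fun _ _ ↦ le_max_right _ _

lemma diskGreen_of_notMem (hx : x ∉ chartPreimage φ (closedBall 0 1)) : diskGreen φ x = 0 := by
  refine Set.indicator_apply_eq_zero.2 fun hxφ ↦ max_eq_right (neg_nonpos.2 (Real.log_nonneg ?_))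
  exact le_of_not_ge fun hle ↦ hx ⟨hxφ, by simpa using hle⟩

variable [ChartedSpace ℂ X]

lemma IsCoordinateDisk.eventually_log_norm_nonpos (hφ : IsCoordinateDisk φ) :
    ∀ᶠ x in 𝓝[≠] (φ.symm 0), x ∈ φ.source ∧ Real.log ‖φ x‖ ≤ 0 := by
  filter_upwards [mem_nhdsWithin_of_mem_nhds ((isOpen_chartPreimage isOpen_ball).mem_nhds
    (symm_mem_chartPreimage hφ.zero_mem_target (mem_ball_self one_pos)))] with x hx
  exact ⟨hx.1, Real.log_nonpos (norm_nonneg _) (mem_ball_zero_iff.1 hx.2).le⟩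

lemma isGreenMinorant_zero (hφ : IsCoordinateDisk φ) : IsGreenMinorant φ Y 0 where
  nonneg _ := le_rfl
  eq_zero _ _ := rfl
  hasCompactSupport := .zero
  isSubharmonicAt _ _ := isSubharmonicAt_const 0
  isBoundedUnder := ⟨0, eventually_map.2 <| hφ.eventually_log_norm_nonpos.mono fun x hx ↦ by
    simpa using hx.2⟩

lemma IsGreenMinorant.sup (hu : IsGreenMinorant φ Y u) (hv : IsGreenMinorant φ Y v) :
    IsGreenMinorant φ Y (u ⊔ v) where
  nonneg x := (hu.nonneg x).trans le_sup_left
  eq_zero x hx := by simp [hu.eq_zero x hx, hv.eq_zero x hx]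
  hasCompactSupport := hu.hasCompactSupport.comp₂_left hv.hasCompactSupport (sup_idem 0)
  isSubharmonicAt x hx := (hu.isSubharmonicAt x hx).sup (hv.isSubharmonicAt x hx)
  isBoundedUnder := by
    simpa only [Pi.sup_apply, max_add_add_right] using hu.isBoundedUnder.sup hv.isBoundedUnder

lemma greenFunction_eq_zero (hφ : IsCoordinateDisk φ) (hx : x ∉ Y) : greenFunction φ Y x = 0 := by
  have heval : ∀ v : {v | IsGreenMinorant φ Y v}, v.1 x = 0 := fun v ↦ v.2.eq_zero x hx
  have : Nonempty {v | IsGreenMinorant φ Y v} := ⟨⟨0, isGreenMinorant_zero hφ⟩⟩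
  rw [greenFunction, sSup_apply]
  simp only [heval, ciSup_const]

variable [IsManifold 𝓘(ℂ) ω X] [T2Space X]

lemma IsCoordinateDisk.isSubharmonicAt_diskGreen (hφ : IsCoordinateDisk φ) (hx : x ≠ φ.symm 0) :
    IsSubharmonicAt (diskGreen φ) x := by
  by_cases hxφ : x ∈ φ.source
  · have hφx : φ x ≠ 0 := (φ.eq_symm_apply hxφ hφ.zero_mem_target).not.1 hx
    refine ((hφ.isHolomorphicChart.isHarmonicAt_log_norm hxφ hφx).neg.isSubharmonicAt.sup
      (isSubharmonicAt_const 0)).congr ?_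
    filter_upwards [φ.open_source.mem_nhds hxφ] with y hy using Set.indicator_of_mem hy _
  · have hclosed := (hφ.isCompact_chartPreimage (isCompact_closedBall 0 1) subset_rfl).isClosed
    refine (isSubharmonicAt_const 0).congr ?_
    filter_upwards [hclosed.isOpen_compl.mem_nhds fun hxb ↦ hxφ hxb.1] with y hy
    exact diskGreen_of_notMem hy

lemma IsCoordinateDisk.isGreenMinorant_diskGreen (hφ : IsCoordinateDisk φ)
    (hφY : φ.source ⊆ Y) : IsGreenMinorant φ Y (diskGreen φ) where
  nonneg := diskGreen_nonneg
  eq_zero x hx := Set.indicator_of_notMem (fun hxφ ↦ hx (hφY hxφ)) _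
  hasCompactSupport := .intro (hφ.isCompact_chartPreimage (isCompact_closedBall 0 1) subset_rfl)
    fun x hx ↦ diskGreen_of_notMem hx
  isSubharmonicAt x hx := hφ.isSubharmonicAt_diskGreen hx
  isBoundedUnder := ⟨0, eventually_map.2 <| hφ.eventually_log_norm_nonpos.mono fun x hx ↦ by
    rw [diskGreen, Set.indicator_of_mem hx.1, max_eq_left (neg_nonneg.2 hx.2), neg_add_cancel]⟩

variable [ConnectedSpace X]

lemma IsGreenMinorant.poissonModification (hv : IsGreenMinorant φ Y v) (hψ : IsCoordinateDisk ψ)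
    (hψY : ψ.source ⊆ Y \ {φ.symm 0}) : IsGreenMinorant φ Y (poissonModification ψ v) where
  nonneg x := (hv.nonneg x).trans
    (hψ.le_poissonModification (fun x hx ↦ hv.isSubharmonicAt x (hψY hx.1).2) x)
  eq_zero x hx := by
    rw [poissonModification_of_notMem fun hxψ ↦ hx (hψY hxψ.1).1, hv.eq_zero x hx]
  hasCompactSupport := by
    refine .intro (hv.hasCompactSupport.isCompact.union
      (hψ.isCompact_chartPreimage (isCompact_closedBall 0 1) subset_rfl)) fun x hx ↦ ?_
    rw [mem_union, not_or] at hx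
    rw [poissonModification_of_notMem
        fun hxψ ↦ hx.2 (chartPreimage_mono ball_subset_closedBall hxψ),
      image_eq_zero_of_notMem_tsupport hx.1]
  isSubharmonicAt x hx := (hv.isSubharmonicAt x hx).poissonModification hψ
    fun y hy ↦ hv.isSubharmonicAt y (hψY hy.1).2
  isBoundedUnder := by
    have hnear := hψ.poissonModification_eventuallyEq (v := v) (x := φ.symm 0)
      fun hpole ↦ (hψY hpole.1).2 rfl
    obtain ⟨M, hM⟩ := hv.isBoundedUnder
    refine ⟨M, eventually_map.2 ?_⟩
    filter_upwards [eventually_map.1 hM, hnear.filter_mono nhdsWithin_le_nhds] with x hx heq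
    rwa [heq]

lemma IsGreenMinorant.add_log_norm_le (hv : IsGreenMinorant φ Y v) (hφ : IsCoordinateDisk φ)
    {m : ℝ} (hm : ∀ x ∈ chartPreimage φ (sphere 0 1), v x ≤ m) :
    ∀ x ∈ chartPreimage φ (closedBall 0 1 \ {0}), v x + Real.log ‖φ x‖ ≤ m := by
  have hsub : ∀ x ∈ chartPreimage φ {0}ᶜ, IsSubharmonicAt (fun x ↦ v x + Real.log ‖φ x‖) x :=
    fun x hx ↦ (hv.isSubharmonicAt x ((φ.eq_symm_apply hx.1 hφ.zero_mem_target).not.2 hx.2)).add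
      (hφ.isHolomorphicChart.isHarmonicAt_log_norm hx.1 hx.2).isSubharmonicAt
  refine hφ.le_of_punctured (fun x hx ↦ (hsub x ⟨hx.1, hx.2.2⟩).continuousAt.continuousWithinAt)
    (fun x hx ↦ hsub x ⟨hx.1, hx.2.2⟩) hv.isBoundedUnder fun x hx ↦ ?_
  rw [mem_sphere_zero_iff_norm.1 hx.2, Real.log_one, add_zero]
  exact hm x hx

lemma IsGreenMinorant.le_of_notMem_chartPreimage_ball (hv : IsGreenMinorant φ Y v)
    (hφ : IsCoordinateDisk φ) {r m : ℝ} (hr : 0 < r) (hr1 : r ≤ 1) (hm0 : 0 ≤ m)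
    (hm : ∀ x ∈ chartPreimage φ (sphere 0 r), v x ≤ m) :
    ∀ x ∉ chartPreimage φ (ball 0 r), v x ≤ m := by
  have hclosed : IsClosed (chartPreimage φ (closedBall 0 r)) := (hφ.isCompact_chartPreimage
    (isCompact_closedBall 0 r) (closedBall_subset_closedBall hr1)).isClosed
  have hmono : chartPreimage φ (ball 0 r) ⊆ chartPreimage φ (closedBall 0 r) :=
    chartPreimage_mono ball_subset_closedBall
  have hpole : φ.symm 0 ∈ chartPreimage φ (ball 0 r) :=
    symm_mem_chartPreimage hφ.zero_mem_target (mem_ball_self hr)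
  have hsub : ∀ x ∉ chartPreimage φ (ball 0 r), IsSubharmonicAt v x := fun x hx ↦
    hv.isSubharmonicAt x fun heq ↦ hx (heq ▸ hpole)
  have hopen : IsOpen ((chartPreimage φ (closedBall 0 r))ᶜ ∩ v ⁻¹' Ioi 0) :=
    ContinuousOn.isOpen_inter_preimage (fun x hx ↦
      (hsub x fun hxr ↦ hx (hmono hxr)).continuousAt.continuousWithinAt) hclosed.isOpen_compl
      isOpen_Ioi
  intro x hx
  by_cases hxv : x ∈ tsupport v
  swap
  · rwa [image_eq_zero_of_notMem_tsupport hxv]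
  refine IsSubharmonicAt.le_const_of_isCompact
    (hv.hasCompactSupport.isCompact.diff (isOpen_chartPreimage isOpen_ball)) hopen
    (fun y hy ↦ ⟨subset_tsupport v (ne_of_gt hy.2), fun hyr ↦ hy.1 (hmono hyr)⟩)
    (fun huniv ↦ (huniv.ge (mem_univ (φ.symm 0))).1 (hmono hpole))
    (fun y hy ↦ (hsub y hy.2).continuousAt.continuousWithinAt)
    (fun y hy ↦ hsub y fun hyr ↦ hy.1 (hmono hyr)) (fun y ⟨hyS, hyO⟩ ↦ ?_) x ⟨hxv, hx⟩
  by_cases hyr : y ∈ chartPreimage φ (closedBall 0 r)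
  · exact hm y ⟨hyr.1, ((ball_union_sphere (x := (0 : ℂ)) (ε := r)).ge hyr.2).resolve_left
      fun hyb ↦ hyS.2 ⟨hyr.1, hyb⟩⟩
  · exact (not_lt.1 fun hpos ↦ hyO ⟨hyr, hpos⟩).trans hm0

lemma IsGreenMinorant.le_add_log_two (hv : IsGreenMinorant φ Y v) (hφ : IsCoordinateDisk φ)
    {m : ℝ} (hm0 : 0 ≤ m) (hm : ∀ x ∈ chartPreimage φ (sphere 0 1), v x ≤ m) :
    ∀ x ∉ chartPreimage φ (ball 0 (1 / 2)), v x ≤ m + Real.log 2 := by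
  refine hv.le_of_notMem_chartPreimage_ball hφ one_half_pos one_half_lt_one.le
    (add_nonneg hm0 (Real.log_nonneg one_le_two)) fun x hx ↦ ?_
  have hmem : φ x ∈ closedBall (0 : ℂ) 1 \ {0} :=
    ⟨sphere_subset_closedBall.trans (closedBall_subset_closedBall one_half_lt_one.le) hx.2,
      ne_of_mem_sphere hx.2 one_half_pos.ne'⟩
  have hle := hv.add_log_norm_le hφ hm x ⟨hx.1, hmem⟩
  rw [mem_sphere_zero_iff_norm.1 hx.2, one_div, Real.log_inv] at hle
  linarith

end GreenMinorant

section GreenFunction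

variable {X : Type*} [TopologicalSpace X] [ChartedSpace ℂ X] [IsManifold 𝓘(ℂ) ω X] [T2Space X]
  [ConnectedSpace X] {φ : OpenPartialHomeomorph X ℂ} {Y : Set X} {x : X}

lemma IsCoordinateDisk.exists_isGreenMinorant_le_mul (hφ : IsCoordinateDisk φ)
    (hφY : φ.source ⊆ Y) (hY : ¬Dense Y) :
    ∃ θ < 1, ∀ v, IsGreenMinorant φ Y v → ∀ b > 0,
      (∀ x ∉ chartPreimage φ (ball 0 (1 / 2)), v x ≤ b) →
      ∀ x ∈ chartPreimage φ (sphere 0 1), v x ≤ θ * b := by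
  obtain ⟨y, hy⟩ : ∃ y, y ∉ closure Y := by simpa [Dense] using hY
  let V : Set (X → ℝ) := {w | (∀ x ∉ chartPreimage φ (closedBall 0 (1 / 2)),
    IsSubharmonicAt w x ∧ w x ≤ 1) ∧ ∀ x ∉ Y, w x = 0}
  have hyV : y ∈ gapLocus V := by
    refine ⟨0, one_pos, ?_⟩
    filter_upwards [isClosed_closure.isOpen_compl.mem_nhds hy] with x hx w hw
    exact (hw.2 x fun hxY ↦ hx (subset_closure hxY)).le
  obtain ⟨θ, hθ, hθV⟩ := hφ.exists_forall_sphere_le_lt_one one_half_pos.le one_half_lt_one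
    (fun x hx w hw ↦ hw.1 x hx) ⟨y, hyV, fun hyφ ↦ hy (subset_closure (hφY hyφ.1))⟩
  refine ⟨θ, hθ, fun v hv b hb hvb x hx ↦ ?_⟩
  have hscaled : b⁻¹ • v ∈ V := by
    refine ⟨fun z hz ↦ ⟨(hv.isSubharmonicAt z ?_).const_smul (inv_pos.2 hb).le, ?_⟩,
      fun z hz ↦ by simp [hv.eq_zero z hz]⟩
    · rintro rfl
      exact hz (symm_mem_chartPreimage hφ.zero_mem_target (by simp))
    · rw [Pi.smul_apply, smul_eq_mul, inv_mul_le_iff₀ hb, mul_one]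
      exact hvb z fun hzb ↦ hz (chartPreimage_mono ball_subset_closedBall hzb)
  have hθx := hθV _ hscaled x hx
  rwa [Pi.smul_apply, smul_eq_mul, inv_mul_le_iff₀ hb, mul_comm] at hθx

theorem IsCoordinateDisk.exists_isGreenMinorant_sphere_le (hφ : IsCoordinateDisk φ)
    (hφY : φ.source ⊆ Y) (hY : ¬Dense Y) :
    ∃ m, 0 ≤ m ∧ ∀ v, IsGreenMinorant φ Y v → ∀ x ∈ chartPreimage φ (sphere 0 1), v x ≤ m := by
  obtain ⟨θ, hθ, hcontract⟩ := hφ.exists_isGreenMinorant_le_mul hφY hY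
  have hlog : 0 < Real.log 2 := Real.log_pos one_lt_two
  refine ⟨|θ * Real.log 2 / (1 - θ)|, abs_nonneg _, fun v hv x hx ↦ ?_⟩
  obtain ⟨x₁, hx₁, hmax⟩ := (hφ.isCompact_chartPreimage (isCompact_sphere 0 1)
    sphere_subset_closedBall).exists_isMaxOn ⟨x, hx⟩ fun y hy ↦ (hv.isSubharmonicAt y
      ((φ.eq_symm_apply hy.1 hφ.zero_mem_target).not.2
        (ne_of_mem_sphere hy.2 one_ne_zero))).continuousAt.continuousWithinAt
  have hself : v x₁ ≤ θ * (v x₁ + Real.log 2) :=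
    hcontract v hv _ (add_pos_of_nonneg_of_pos (hv.nonneg x₁) hlog)
      (hv.le_add_log_two hφ (hv.nonneg x₁) fun y hy ↦ hmax hy) x₁ hx₁
  calc v x ≤ v x₁ := hmax hx
    _ ≤ θ * Real.log 2 / (1 - θ) := by
      rw [le_div_iff₀ (sub_pos.2 hθ)]
      linarith
    _ ≤ |θ * Real.log 2 / (1 - θ)| := le_abs_self _

lemma IsCoordinateDisk.exists_isGreenMinorant_le_of_notMem (hφ : IsCoordinateDisk φ)
    (hφY : φ.source ⊆ Y) (hY : ¬Dense Y) {N : Set X} (hN : N ∈ 𝓝 (φ.symm 0)) :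
    ∃ M, 0 ≤ M ∧ ∀ v, IsGreenMinorant φ Y v → ∀ x ∉ N, v x ≤ M := by
  obtain ⟨m, hm, hbound⟩ := hφ.exists_isGreenMinorant_sphere_le hφY hY
  obtain ⟨δ, hδ, hδN⟩ := Metric.mem_nhds_iff.1 (φ.continuousAt_symm hφ.zero_mem_target hN)
  refine ⟨m + |Real.log δ|, by positivity, fun v hv x hx ↦ ?_⟩
  by_cases hxφ : x ∈ chartPreimage φ (ball 0 1)
  · have hδx : δ ≤ ‖φ x‖ := by
      by_contra! hlt
      have hmem : φ.symm (φ x) ∈ N := hδN (mem_ball_zero_iff.2 hlt)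
      exact hx (φ.left_inv hxφ.1 ▸ hmem)
    have hle := hv.add_log_norm_le hφ (hbound v hv) x
      ⟨hxφ.1, ball_subset_closedBall hxφ.2, norm_pos_iff.1 (hδ.trans_le hδx)⟩
    linarith [Real.log_le_log hδ hδx, neg_abs_le (Real.log δ)]
  · have hle := hv.le_of_notMem_chartPreimage_ball hφ one_pos le_rfl hm (hbound v hv) x hxφ
    linarith [abs_nonneg (Real.log δ)]

theorem IsCoordinateDisk.isPerronFamily_isGreenMinorant (hφ : IsCoordinateDisk φ)
    (hφY : φ.source ⊆ Y) (hY : ¬Dense Y) :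
    IsPerronFamily {v | IsGreenMinorant φ Y v} (Y \ {φ.symm 0}) where
  nonempty := ⟨0, isGreenMinorant_zero hφ⟩
  isSubharmonicAt _ hv x hx := hv.isSubharmonicAt x hx.2
  nonneg _ hv x _ := hv.nonneg x
  bddAbove x hx := by
    obtain ⟨M, -, hM⟩ := hφ.exists_isGreenMinorant_le_of_notMem hφY hY
      (isOpen_ne.mem_nhds (Ne.symm hx.2))
    exact ⟨M, forall_mem_image.2 fun v hv ↦ hM v hv x (by simp)⟩
  sup_mem _ hu _ hv := hu.sup hv
  poissonModification_mem _ hψ hψY _ hv := hv.poissonModification hψ hψY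

theorem IsCoordinateDisk.isHarmonicAt_greenFunction (hφ : IsCoordinateDisk φ)
    (hφY : φ.source ⊆ Y) (hY : ¬Dense Y) (hY_open : IsOpen Y) (hx : x ∈ Y \ {φ.symm 0}) :
    IsHarmonicAt (greenFunction φ Y) x :=
  (hφ.isPerronFamily_isGreenMinorant hφY hY).isHarmonicAt_sSup
    (hY_open.sdiff isClosed_singleton) hx

lemma IsCoordinateDisk.greenFunction_nonneg (hφ : IsCoordinateDisk φ) (hφY : φ.source ⊆ Y)
    (hY : ¬Dense Y) (hx : x ≠ φ.symm 0) : 0 ≤ greenFunction φ Y x := by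
  by_cases hxY : x ∈ Y
  · exact (hφ.isPerronFamily_isGreenMinorant hφY hY).le_sSup (isGreenMinorant_zero hφ) ⟨hxY, hx⟩
  · exact (greenFunction_eq_zero hφ hxY).ge

theorem IsCoordinateDisk.exists_abs_greenFunction_add_log_le (hφ : IsCoordinateDisk φ)
    (hφY : φ.source ⊆ Y) (hY : ¬Dense Y) :
    ∃ m, ∀ x ∈ chartPreimage φ (ball 0 1 \ {0}), |greenFunction φ Y x + Real.log ‖φ x‖| ≤ m := by
  obtain ⟨m, hm, hbound⟩ := hφ.exists_isGreenMinorant_sphere_le hφY hY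
  have hperron := hφ.isPerronFamily_isGreenMinorant hφY hY
  refine ⟨m, fun x hx ↦ abs_le.2 ⟨?_, ?_⟩⟩
  · have hx_ne : x ≠ φ.symm 0 := (φ.eq_symm_apply hx.1 hφ.zero_mem_target).not.2 hx.2.2
    have hdisk : -Real.log ‖φ x‖ ≤ diskGreen φ x := by
      rw [diskGreen, Set.indicator_of_mem hx.1]
      exact le_max_left _ _
    have hle : diskGreen φ x ≤ greenFunction φ Y x :=
      hperron.le_sSup (hφ.isGreenMinorant_diskGreen hφY) ⟨hφY hx.1, hx_ne⟩
    linarith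
  · have hle : greenFunction φ Y x ≤ m - Real.log ‖φ x‖ := hperron.sSup_le fun v hv ↦ by
      linarith [hv.add_log_norm_le hφ (hbound v hv) x
        ⟨hx.1, ball_subset_closedBall hx.2.1, hx.2.2⟩]
    linarith

end GreenFunction

/-! ### Boundary values -/

section ExteriorBall

variable {E F : Type*} [NormedAddCommGroup E] [NormedAddCommGroup F] [NormedSpace ℝ F]

lemma isBigO_sub_sub_fderiv_of_contDiffAt [NormedSpace ℝ E] {f : E → F} {x : E}
    (hf : ContDiffAt ℝ 2 f x) :
    (fun y ↦ f y - f x - fderiv ℝ f x (y - x)) =O[𝓝 x] fun y ↦ ‖y - x‖ ^ 2 := by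
  have hfderiv : DifferentiableAt ℝ (fderiv ℝ f) x :=
    (hf.fderiv_right (m := 1) one_add_one_eq_two.le).differentiableAt one_ne_zero
  have hdiff : ∀ᶠ y in 𝓝 x, DifferentiableAt ℝ f y :=
    (hf.eventually (by simp)).mono fun y hy ↦ hy.differentiableAt two_ne_zero
  obtain ⟨C, hC, hbound⟩ := hfderiv.isBigO_sub.exists_nonneg
  obtain ⟨δ, hδ, hball⟩ := Metric.eventually_nhds_iff_ball.1 (hdiff.and hbound.bound)
  refine .of_bound C (eventually_of_mem (ball_mem_nhds x hδ) fun y hy ↦ ?_)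
  have hsub : ∀ z ∈ closedBall x ‖y - x‖, z ∈ ball x δ := fun z hz ↦
    (mem_closedBall.1 hz).trans_lt (by simpa [dist_eq_norm] using hy)
  have hmean : ‖f y - f x - fderiv ℝ f x (y - x)‖ ≤ C * ‖y - x‖ * ‖y - x‖ :=
    (convex_closedBall x ‖y - x‖).norm_image_sub_le_of_norm_hasFDerivWithin_le'
      (fun z hz ↦ (hball z (hsub z hz)).1.hasFDerivAt.hasFDerivWithinAt)
      (fun z hz ↦ (hball z (hsub z hz)).2.trans
        (mul_le_mul_of_nonneg_left (mem_closedBall_iff_norm.1 hz) hC))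
      (mem_closedBall_self (norm_nonneg _)) (mem_closedBall_iff_norm.2 le_rfl)
  rwa [norm_pow, norm_norm, sq, ← mul_assoc]

variable [InnerProductSpace ℝ E]

lemma exists_ne_eventually_dist_le_of_contDiffAt [CompleteSpace E] {f : E → ℝ} {q : E}
    (hf : ContDiffAt ℝ 2 f q) (hd : fderiv ℝ f q ≠ 0) :
    ∃ c ≠ q, ∀ᶠ z in 𝓝 q, f z ≤ f q → dist q c ≤ dist z c := by
  obtain ⟨C, hC, hbound⟩ := (isBigO_sub_sub_fderiv_of_contDiffAt hf).exists_pos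
  set a : E := (InnerProductSpace.toDual ℝ E).symm (fderiv ℝ f q) with ha
  have ha_ne : a ≠ 0 := by simpa [ha] using hd
  refine ⟨q + (2 * C)⁻¹ • a, by simp [ha_ne, hC.ne'], ?_⟩
  filter_upwards [hbound.bound] with z hz hfz
  have hinner : inner ℝ (z - q) a ≤ C * ‖z - q‖ ^ 2 := by
    rw [real_inner_comm, ha, InnerProductSpace.toDual_symm_apply]
    rw [norm_pow, norm_norm] at hz
    linarith [(abs_le.1 hz).1]
  have hexpand : ‖z - q - (2 * C)⁻¹ • a‖ ^ 2 =
      ‖z - q‖ ^ 2 - C⁻¹ * inner ℝ (z - q) a + ‖(2 * C)⁻¹ • a‖ ^ 2 := by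
    rw [norm_sub_sq_real, real_inner_smul_right]
    ring
  have hscaled : C⁻¹ * inner ℝ (z - q) a ≤ ‖z - q‖ ^ 2 := by
    rwa [inv_mul_le_iff₀ hC]
  rw [dist_self_add_right, dist_eq_norm, ← sub_sub]
  exact le_of_sq_le_sq (by linarith) (norm_nonneg _)

/- The witness `m` is the centre of the disk of half the radius that is internally tangent at `q` to
the disk around `c`: off the larger disk, the distance to `m` grows strictly away from `q`. -/
lemma exists_lt_dist_of_dist_le {c q : E} (hc : c ≠ q) {δ : ℝ} (hδ : 0 < δ) :
    ∃ m, ∃ r > 0, ∃ R > r, dist q m = r ∧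
      ∀ z, dist q c ≤ dist z c → r ≤ dist z m ∧ (δ ≤ dist z q → R ≤ dist z m) := by
  have hr : 0 < dist q c / 2 := half_pos (dist_pos.2 hc.symm)
  refine ⟨midpoint ℝ c q, dist q c / 2, hr, √((dist q c / 2) ^ 2 + δ ^ 2 / 2),
    Real.lt_sqrt_of_sq_lt (lt_add_of_pos_right _ (by positivity)), ?_, fun z hz ↦ ?_⟩
  · rw [dist_comm, dist_midpoint_right, Real.norm_two, dist_comm c, inv_mul_eq_div]
  have hapollonius : (dist q c / 2) ^ 2 + dist z q ^ 2 / 2 ≤ dist z (midpoint ℝ c q) ^ 2 := by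
    have heq :=
      EuclideanGeometry.dist_sq_add_dist_sq_eq_two_mul_dist_midpoint_sq_add_half_dist_sq z c q
    rw [dist_comm c q] at heq
    linarith [pow_le_pow_left₀ dist_nonneg hz 2]
  refine ⟨le_of_sq_le_sq ?_ dist_nonneg, fun hδz ↦ Real.sqrt_le_iff.2 ⟨dist_nonneg, ?_⟩⟩
  · linarith [sq_nonneg (dist z q)]
  · linarith [pow_le_pow_left₀ hδ.le hδz 2]

end ExteriorBall

/-- `Y` satisfies the exterior disk condition at `p`: in a holomorphic coordinate at `p`, the image
of `Y` near `p` stays outside an open disk whose boundary circle passes through the image of `p`. -/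
def HasExteriorDisk {X : Type*} [TopologicalSpace X] [ChartedSpace ℂ X] (Y : Set X) (p : X) :
    Prop :=
  ∃ (ψ : OpenPartialHomeomorph X ℂ) (c : ℂ), IsHolomorphicChart ψ ∧ p ∈ ψ.source ∧ c ≠ ψ p ∧
    ∀ᶠ x in 𝓝 p, x ∈ Y → dist (ψ p) c ≤ dist (ψ x) c

section ExteriorDisk

variable {X : Type*} [TopologicalSpace X] [ChartedSpace ℂ X] {K N Y : Set X} {p : X}

lemma IsSubsurfaceWithSmoothBoundary.hasExteriorDisk (hK : IsSubsurfaceWithSmoothBoundary K)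
    (hp : p ∈ subsurfaceBoundary K) : HasExteriorDisk (interior K) p := by
  obtain ⟨ψ, ρ, hψ, hpψ, hρ, hd, hKρ⟩ := hK p hp.1 hp.2
  have hρp : ContDiffAt ℝ ∞ ρ (ψ p) :=
    hρ.contDiffAt (ψ.open_target.mem_nhds (ψ.map_source hpψ))
  have hnonneg : 0 ≤ ρ (ψ p) := by
    by_contra! hneg
    refine hp.2 (mem_interior_iff_mem_nhds.2 ?_)
    filter_upwards [(hρp.continuousAt.comp (ψ.continuousAt hpψ)).eventually_lt_const hneg,
      ψ.open_source.mem_nhds hpψ] with x hx hxψ using (hKρ x hxψ).2 hx.le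
  obtain ⟨c, hc, hdist⟩ := exists_ne_eventually_dist_le_of_contDiffAt (hρp.of_le (by norm_cast)) hd
  refine ⟨ψ, c, hψ, hpψ, hc, ?_⟩
  filter_upwards [(ψ.continuousAt hpψ).eventually hdist, ψ.open_source.mem_nhds hpψ]
    with x hx hxψ hxK
  exact hx (((hKρ x hxψ).1 (interior_subset hxK)).trans hnonneg)

lemma HasExteriorDisk.not_dense (hp : HasExteriorDisk Y p) : ¬Dense Y := by
  obtain ⟨ψ, c, -, hpψ, hc, hdist⟩ := hp
  intro hY
  obtain ⟨r, hr, hball⟩ := (eventually_forall_closedBall_of_eventually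
    (eventually_eventually_nhds.2 hdist) hpψ).exists
  have hclosure : ψ p ∈ closure (ball c (dist (ψ p) c)) := by
    rw [closure_ball c (dist_pos.2 hc.symm).ne']
    exact mem_closedBall.2 le_rfl
  obtain ⟨z, hzr, hzc⟩ := mem_closure_iff_nhds.1 hclosure _ (closedBall_mem_nhds _ hr)
  have hinside : ∀ᶠ x in 𝓝 (ψ.symm z), dist (ψ x) c < dist (ψ p) c := by
    refine ((ψ.continuousAt (ψ.map_target (hball z hzr).1)).dist
      continuousAt_const).eventually_lt_const ?_
    rwa [ψ.right_inv (hball z hzr).1]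
  obtain ⟨x, ⟨hxlt, hxle⟩, hxY⟩ :=
    mem_closure_iff_nhds.1 (hY (ψ.symm z)) _ (hinside.and (hball z hzr).2)
  exact (hxle hxY).not_gt hxlt

variable [IsManifold 𝓘(ℂ) ω X]

lemma HasExteriorDisk.exists_barrier (hp : HasExteriorDisk Y p) (hN : N ∈ 𝓝 p) :
    ∃ (V S : Set X) (b : X → ℝ), IsOpen V ∧ p ∈ V ∧ V ∩ Y ⊆ S ∧ IsCompact S ∧ S ⊆ N ∧
      ContinuousAt b p ∧ b p = 0 ∧ (∀ x ∈ S, IsHarmonicAt b x ∧ 0 ≤ b x) ∧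
      ∀ x ∈ S \ V, 1 ≤ b x := by
  obtain ⟨ψ, c, hψ, hpψ, hc, hdist⟩ := hp
  obtain ⟨δ, hδ, hball⟩ :=
    (eventually_forall_closedBall_of_eventually (hdist.and hN) hpψ).exists
  have hnear : ∀ x ∈ chartPreimage ψ (closedBall (ψ p) δ),
      (x ∈ Y → dist (ψ p) c ≤ dist (ψ x) c) ∧ x ∈ N := fun x hx ↦ by
    have hmem := (hball (ψ x) hx.2).2
    rwa [ψ.left_inv hx.1] at hmem
  obtain ⟨m, r, hr, R, hrR, hpm, hm⟩ := exists_lt_dist_of_dist_le hc hδ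
  have hlog : 0 < Real.log R - Real.log r := sub_pos.2 (Real.log_lt_log hr hrR)
  let b : X → ℝ := (Real.log R - Real.log r)⁻¹ • fun x ↦ Real.log ‖ψ x - m‖ + -Real.log r
  have hb : ∀ x, b x = (Real.log R - Real.log r)⁻¹ * (Real.log (dist (ψ x) m) - Real.log r) :=
    fun x ↦ by rw [dist_eq_norm]; rfl
  have hharm : ∀ x ∈ ψ.source, r ≤ dist (ψ x) m → IsHarmonicAt b x := fun x hx hle ↦
    ((hψ.isHarmonicAt_log_norm_sub hx (dist_pos.1 (hr.trans_le hle))).add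
      (isHarmonicAt_const _)).const_smul _
  refine ⟨chartPreimage ψ (ball (ψ p) δ),
    chartPreimage ψ (closedBall (ψ p) δ \ ball c (dist (ψ p) c)), b,
    isOpen_chartPreimage isOpen_ball, ⟨hpψ, mem_ball_self hδ⟩, fun x ⟨hxV, hxY⟩ ↦ ?_,
    isCompact_chartPreimage ((isCompact_closedBall _ _).diff isOpen_ball)
      fun z hz ↦ (hball z hz.1).1,
    fun x hx ↦ (hnear x ⟨hx.1, hx.2.1⟩).2, (hharm p hpψ hpm.ge).continuousAt,
    by rw [hb, hpm, sub_self, mul_zero], fun x hx ↦ ?_, fun x ⟨hx, hxV⟩ ↦ ?_⟩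
  · have hxδ : ψ x ∈ closedBall (ψ p) δ := ball_subset_closedBall hxV.2
    exact ⟨hxV.1, hxδ, not_lt.2 ((hnear x ⟨hxV.1, hxδ⟩).1 hxY)⟩
  · have hrx : r ≤ dist (ψ x) m := (hm _ (not_lt.1 hx.2.2)).1
    refine ⟨hharm x hx.1 hrx, hb x ▸ mul_nonneg (inv_nonneg.2 hlog.le) ?_⟩
    exact sub_nonneg.2 (Real.log_le_log hr hrx)
  · have hRx : R ≤ dist (ψ x) m :=
      (hm _ (not_lt.1 hx.2.2)).2 (not_lt.1 fun hlt ↦ hxV ⟨hx.1, hlt⟩)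
    rw [hb, le_inv_mul_iff₀ hlog, mul_one]
    exact sub_le_sub_right (Real.log_le_log (hr.trans hrR) hRx) _

variable [T2Space X] [ConnectedSpace X] {φ : OpenPartialHomeomorph X ℂ}

lemma IsGreenMinorant.le_mul_barrier {v b : X → ℝ} {V S : Set X} {M : ℝ}
    (hv : IsGreenMinorant φ Y v) (hY : IsOpen Y) (hV : IsOpen V) (hVS : V ∩ Y ⊆ S)
    (hS : IsCompact S) (hpole : φ.symm 0 ∉ S) (hM : 0 ≤ M) (hvM : ∀ x ∈ S, v x ≤ M)
    (hb : ∀ x ∈ S, IsHarmonicAt b x ∧ 0 ≤ b x) (hb1 : ∀ x ∈ S \ V, 1 ≤ b x) :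
    ∀ x ∈ S, v x ≤ M * b x := by
  have hsub : ∀ x ∈ S, IsSubharmonicAt v x := fun x hx ↦
    hv.isSubharmonicAt x fun heq ↦ hpole (heq ▸ hx)
  have hharm : ∀ x ∈ S, IsHarmonicAt (M • b) x := fun x hx ↦ (hb x hx).1.const_smul M
  refine IsSubharmonicAt.le_of_isCompact hS (hV.inter hY) hVS
    (fun huniv ↦ hpole (hVS (huniv ▸ mem_univ _)))
    (fun x hx ↦ (hsub x hx).continuousAt.continuousWithinAt)
    (fun x hx ↦ (hharm x hx).continuousAt.continuousWithinAt)
    (fun x hx ↦ hsub x (hVS hx)) (fun x hx ↦ hharm x (hVS hx)) fun x ⟨hxS, hx⟩ ↦ ?_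
  by_cases hxY : x ∈ Y
  · exact (hvM x hxS).trans (le_mul_of_one_le_right hM (hb1 x ⟨hxS, fun hxV ↦ hx ⟨hxV, hxY⟩⟩))
  · exact (hv.eq_zero x hxY).trans_le (mul_nonneg hM (hb x hxS).2)

theorem HasExteriorDisk.continuousAt_greenFunction (hp : HasExteriorDisk Y p) (hpY : p ∉ Y)
    (hφ : IsCoordinateDisk φ) (hφY : φ.source ⊆ Y) (hY : IsOpen Y) :
    ContinuousAt (greenFunction φ Y) p := by
  have hp_ne : p ≠ φ.symm 0 := by
    rintro rfl
    exact hpY (hφY (φ.map_target hφ.zero_mem_target))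
  obtain ⟨N, hN, N', hN', hNN'⟩ := Filter.disjoint_iff.1 (disjoint_nhds_nhds.2 hp_ne)
  obtain ⟨M, hM, hvM⟩ := hφ.exists_isGreenMinorant_le_of_notMem hφY hp.not_dense hN'
  obtain ⟨V, S, b, hV, hpV, hVS, hS, hSN, hb_cont, hbp, hb, hb1⟩ := hp.exists_barrier hN
  have hSN' : ∀ x ∈ S, x ∉ N' := fun x hx ↦ hNN'.notMem_of_mem_left (hSN hx)
  have hlim : Tendsto (fun x ↦ M * |b x|) (𝓝 p) (𝓝 0) := by
    simpa [hbp] using (hb_cont.abs.const_mul M).tendsto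
  rw [ContinuousAt, greenFunction_eq_zero hφ hpY]
  refine tendsto_of_tendsto_of_tendsto_of_le_of_le' tendsto_const_nhds hlim ?_ ?_
  · filter_upwards [isOpen_ne.mem_nhds hp_ne] with x hx
    exact hφ.greenFunction_nonneg hφY hp.not_dense hx
  · filter_upwards [hV.mem_nhds hpV] with x hxV
    by_cases hxY : x ∈ Y
    · refine (hφ.isPerronFamily_isGreenMinorant hφY hp.not_dense).sSup_le fun v hv ↦ ?_
      exact (hv.le_mul_barrier hY hV hVS hS (fun hS' ↦ hSN' _ hS' (mem_of_mem_nhds hN')) hM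
        (fun y hy ↦ hvM v hv y (hSN' y hy)) hb hb1 x (hVS ⟨hxV, hxY⟩)).trans
        (mul_le_mul_of_nonneg_left (le_abs_self _) hM)
    · rw [greenFunction_eq_zero hφ hxY]
      positivity

end ExteriorDisk

/-! ### The logarithmic pole -/

section LogarithmicPole

variable {X : Type*} [TopologicalSpace X] [ChartedSpace ℂ X]
  {φ ξ : OpenPartialHomeomorph X ℂ} {x₀ : X}

lemma IsHolomorphicChart.exists_eventually_log_norm_le (hφ : IsHolomorphicChart φ)
    (hξ : IsHolomorphicChart ξ) (hxφ : x₀ ∈ φ.source) (hxξ : x₀ ∈ ξ.source) (hφ0 : φ x₀ = 0)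
    (hξ0 : ξ x₀ = 0) :
    ∃ C, ∀ᶠ x in 𝓝[≠] x₀, Real.log ‖φ x‖ ≤ C + Real.log ‖ξ x‖ := by
  have hanalytic : AnalyticAt ℂ (φ ∘ ξ.symm) (ξ x₀) :=
    hφ.analyticAt_comp_symm hξ (ξ.map_source hxξ) (by rwa [ξ.left_inv hxξ])
  obtain ⟨C, hC, hbound⟩ := hanalytic.differentiableAt.isBigO_sub.exists_pos
  refine ⟨Real.log C, ?_⟩
  filter_upwards [((ξ.continuousAt hxξ).eventually hbound.bound).filter_mono nhdsWithin_le_nhds,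
    mem_nhdsWithin_of_mem_nhds (φ.open_source.mem_nhds hxφ),
    mem_nhdsWithin_of_mem_nhds (ξ.open_source.mem_nhds hxξ), self_mem_nhdsWithin]
    with x hx hxφ' hxξ' hne
  have hφx : 0 < ‖φ x‖ := norm_pos_iff.2 fun h ↦ hne (φ.injOn hxφ' hxφ (h.trans hφ0.symm))
  have hξx : 0 < ‖ξ x‖ := norm_pos_iff.2 fun h ↦ hne (ξ.injOn hxξ' hxξ (h.trans hξ0.symm))
  rw [Function.comp_apply, Function.comp_apply, ξ.left_inv hxξ', ξ.left_inv hxξ, hφ0, hξ0, sub_zero,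
    sub_zero] at hx
  rw [← Real.log_mul hC.ne' hξx.ne']
  exact Real.log_le_log hφx hx

variable [IsManifold 𝓘(ℂ) ω X] [T2Space X] [ConnectedSpace X]

theorem hasLogarithmicPole_of_eventually_abs_le {G : X → ℝ} {m : ℝ}
    (hG : ∀ᶠ x in 𝓝[≠] x₀, IsHarmonicAt G x) (hφ : IsHolomorphicChart φ) (hxφ : x₀ ∈ φ.source)
    (hφ0 : φ x₀ = 0) (hm : ∀ᶠ x in 𝓝[≠] x₀, |G x + Real.log ‖φ x‖| ≤ m) :
    HasLogarithmicPole G x₀ := by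
  intro ξ hξ hxξ hξ0
  obtain ⟨C₁, hC₁⟩ := hφ.exists_eventually_log_norm_le hξ hxφ hxξ hφ0 hξ0
  obtain ⟨C₂, hC₂⟩ := hξ.exists_eventually_log_norm_le hφ hxξ hxφ hξ0 hφ0
  have hξ_mem := ξ.open_source.mem_nhds hxξ
  have hharm : ∀ᶠ x in 𝓝[≠] x₀, IsHarmonicAt (fun y ↦ G y + Real.log ‖ξ y‖) x := by
    filter_upwards [hG, mem_nhdsWithin_of_mem_nhds hξ_mem, self_mem_nhdsWithin] with x hx hxξ' hne
    exact hx.add (hξ.isHarmonicAt_log_norm hxξ' fun h ↦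
      hne (ξ.injOn hxξ' hxξ (h.trans hξ0.symm)))
  obtain ⟨H, hH, hHG⟩ := exists_isHarmonicAt_eventuallyEq_of_isBoundedUnder hharm
    ⟨m + C₂, eventually_map.2 <| (hm.and hC₂).mono fun x hx ↦ by
      linarith [(abs_le.1 hx.1).2, hx.2]⟩
    ⟨-m - C₁, eventually_map.2 <| (hm.and hC₁).mono fun x hx ↦ by
      linarith [(abs_le.1 hx.1).1, hx.2]⟩
  obtain ⟨V, hV_sub, hV, hx₀V⟩ := mem_nhds_iff.1
    (hH.eventually.and ((eventually_nhdsWithin_iff.1 hHG).and hξ_mem))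
  exact ⟨V, H, hV, hx₀V, fun x hx ↦ (hV_sub hx).2.2,
    (isHarmonicOn_iff_forall_isHarmonicAt hV).2 fun x hx ↦ (hV_sub hx).1,
    fun x hx ↦ (hV_sub hx.1).2.1 hx.2⟩

theorem IsCoordinateDisk.hasLogarithmicPole_greenFunction {Y : Set X} (hφ : IsCoordinateDisk φ)
    (hφY : φ.source ⊆ Y) (hY : ¬Dense Y) (hY_open : IsOpen Y) :
    HasLogarithmicPole (greenFunction φ Y) (φ.symm 0) := by
  obtain ⟨m, hm⟩ := hφ.exists_abs_greenFunction_add_log_le hφY hY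
  have hdisk : ∀ᶠ x in 𝓝[≠] (φ.symm 0), x ∈ chartPreimage φ (ball 0 1 \ {0}) := by
    filter_upwards [mem_nhdsWithin_of_mem_nhds ((isOpen_chartPreimage isOpen_ball).mem_nhds
      (symm_mem_chartPreimage hφ.zero_mem_target (mem_ball_self one_pos))),
      self_mem_nhdsWithin] with x hx hne
    exact ⟨hx.1, hx.2, (φ.eq_symm_apply hx.1 hφ.zero_mem_target).not.1 hne⟩
  refine hasLogarithmicPole_of_eventually_abs_le ?_ hφ.isHolomorphicChart
    (φ.map_target hφ.zero_mem_target) (φ.right_inv hφ.zero_mem_target) (hdisk.mono hm)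
  filter_upwards [hdisk, self_mem_nhdsWithin] with x hx hne
  exact hφ.isHarmonicAt_greenFunction hφY hY hY_open ⟨hφY hx.1, hne⟩

end LogarithmicPole

theorem mainTheorem6_general {X : Type*} [TopologicalSpace X] [T2Space X] [ConnectedSpace X]
    [ChartedSpace ℂ X] [IsManifold 𝓘(ℂ) ω X] (K : Set X)
    (hK : ∀ p ∈ subsurfaceBoundary K, HasExteriorDisk (interior K) p) (hdense : ¬Dense (interior K))
    (x₀ : X) (hx₀ : x₀ ∈ interior K) :
    ∃ G : X → ℝ,
      ContinuousOn G (K \ {x₀}) ∧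
      (∀ x ∈ K \ {x₀}, 0 ≤ G x) ∧
      IsHarmonicOn G (interior (K \ {x₀})) ∧
      (∀ x ∈ subsurfaceBoundary K, G x = 0) ∧
      HasLogarithmicPole G x₀ := by
  obtain ⟨φ, hφ, hxφ, hφK, hφ0⟩ := exists_isCoordinateDisk_centered (isOpen_interior.mem_nhds hx₀)
  obtain rfl : x₀ = φ.symm 0 := (φ.eq_symm_apply hxφ hφ.zero_mem_target).2 hφ0
  have hharm : ∀ x ∈ interior K \ {φ.symm 0}, IsHarmonicAt (greenFunction φ (interior K)) x :=
    fun x hx ↦ hφ.isHarmonicAt_greenFunction hφK hdense isOpen_interior hx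
  refine ⟨greenFunction φ (interior K), fun x hx ↦ ContinuousAt.continuousWithinAt ?_,
    fun x hx ↦ hφ.greenFunction_nonneg hφK hdense hx.2,
    (isHarmonicOn_iff_forall_isHarmonicAt isOpen_interior).2 fun x hx ↦
      hharm x ⟨interior_mono sdiff_subset hx, (interior_subset hx).2⟩,
    fun x hx ↦ greenFunction_eq_zero hφ hx.2,
    hφ.hasLogarithmicPole_greenFunction hφK hdense isOpen_interior⟩
  by_cases hxK : x ∈ interior K
  · exact (hharm x ⟨hxK, hx.2⟩).continuousAt
  · exact (hK x ⟨hx.1, hxK⟩).continuousAt_greenFunction hxK hφ hφK isOpen_interior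

theorem mainTheorem6 {X : Type*} [TopologicalSpace X] [T2Space X] [ConnectedSpace X]
    [ChartedSpace ℂ X] [IsManifold 𝓘(ℂ) ω X]
    (K : Set X) (hK : IsSubsurfaceWithSmoothBoundary K) (hne : (subsurfaceBoundary K).Nonempty)
    (x₀ : X) (hx₀ : x₀ ∈ interior K) :
    ∃ G : X → ℝ,
      ContinuousOn G (K \ {x₀}) ∧
      (∀ x ∈ K \ {x₀}, 0 ≤ G x) ∧
      IsHarmonicOn G (interior (K \ {x₀})) ∧
      (∀ x ∈ subsurfaceBoundary K, G x = 0) ∧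
      HasLogarithmicPole G x₀ :=
  mainTheorem6_general K (fun _ ↦ hK.hasExteriorDisk) (hK.hasExteriorDisk hne.some_mem).not_dense
    x₀ hx₀
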